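/- All alphabets are finite. A (multi-valued partial) function $f$ assigns to every $x\in\Sigma^*$ a set $f(x)\subseteq\Gamma^*$; it is single-valued if $|f(x)|\le 1$ for all $x$, and total if $f(x)\neq\emptyset$ for all $x$. An npda with output tape is a one-way nondeterministic pushdown automaton (finitely many states and stack symbols, finitely many choices per move, $\lambda$-moves allowed) which reads its input $x$ between endmarkers, as $\cent x\dollar$, which in each move writes at most one symbol on a write-only output tape, which halts exactly on entering an accepting or a rejecting state, and all of whose computation paths on inputs of length $n$ reach a halting state within $O(n)$ steps. It computes the function $f$ for which $f(x)$ is the set of strings on the output tape at the end of the accepting computation paths on $x$. Let $\mathrm{CFLMV}$ be the class of functions computed in this way. An oracle npda with oracle $A\subseteq\Delta^*$ has in addition a write-only query tape over $\Delta$, on which each move writes at most one symbol, and three special states $q_{query},q_{yes},q_{no}$: whenever it enters $q_{query}$, with the string $s$ on the query tape, the query tape is erased, and the next state is $q_{yes}$ if $s\in A$ and $q_{no}$ otherwise. All its computation paths on inputs of length $n$ must reach a halting state within $O(n)$ steps, no matter what oracle is used. Let $\mathrm{CFL}_T^A$ be the class of languages accepted by oracle npda's (without output tape) with oracle $A$,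 and let $\mathrm{CFLMV}_T^A$ be the class of functions computed by oracle npda's with an output tape and oracle $A$; for a class $\mathcal C$ of languages put $\mathrm{CFL}_T(\mathcal C)=\bigcup_{A\in\mathcal C}\mathrm{CFL}_T^A$ and $\mathrm{CFLMV}_T(\mathcal C)=\bigcup_{A\in\mathcal C}\mathrm{CFLMV}_T^A$. Let $\Sigma_1^{\mathrm{CFL}}$ be the class of context-free languages and, for $k\ge 1$, let $\Pi_k^{\mathrm{CFL}}$ be the class of complements of languages in $\Sigma_k^{\mathrm{CFL}}$, and $\Sigma_{k+1}^{\mathrm{CFL}}=\mathrm{CFL}_T(\Pi_k^{\mathrm{CFL}})$. Let $\Sigma_1^{\mathrm{CFL}}\mathrm{MV}=\mathrm{CFLMV}$ and $\Sigma_{k+1}^{\mathrm{CFL}}\mathrm{MV}=\mathrm{CFLMV}_T(\Pi_k^{\mathrm{CFL}})$ for $k\ge1$, and let $\Sigma_k^{\mathrm{CFL}}\mathrm{SV}_t$ be the class of single-valued total functions in $\Sigma_k^{\mathrm{CFL}}\mathrm{MV}$. Then, for every $k\ge 1$ and every $f\in\Sigma_k^{\mathrm{CFL}}\mathrm{SV}_t$,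 there is a deterministic multi-tape Turing machine that on every input $x$ halts with the unique element of $f(x)$ as its output, and that on every input of length $n$ scans $O(n)$ tape cells. -/

import Mathlib

/-! ### Generalities on computations -/

/-- `ReachesIn r t c d`: there is a computation path of exactly `t` steps from `c` to `d`. -/
inductive ReachesIn {C : Type*} (r : C → C → Prop) : ℕ → C → C → Prop
  | refl (c : C) : ReachesIn r 0 c c
  | tail {t : ℕ} {c d e : C} : ReachesIn r t c d → r d e → ReachesIn r (t + 1) c e

/-- Every computation path from `c` reaches a halting configuration within `T` steps: no path is
longer than `T`, and a path can only stop in a halting configuration. -/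
def TerminatesWithin {C : Type*} (r : C → C → Prop) (halting : C → Prop) (c : C) (T : ℕ) : Prop :=
  ∀ t d, ReachesIn r t c d → t ≤ T ∧ ((∀ e, ¬ r d e) → halting d)

/-- Symbols on the input tape of a pushdown automaton: letters and the two endmarkers. -/
inductive InputSym (α : Type) : Type
  | cent : InputSym α
  | letter (a : α) : InputSym α
  | dollar : InputSym α

/-- The content `¢ x $` of the input tape on input `x`. -/
def inputTape {α : Type} (x : List α) : List (InputSym α) :=
  InputSym.cent :: (x.map InputSym.letter ++ [InputSym.dollar])

/-! ### Pushdown automata with an output tape -/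

/-- One-way nondeterministic pushdown automata over the input alphabet `α`. A move is determined by
the state, by the scanned input symbol (`some s`) or a `λ`-move (`none`), and by the topmost stack
symbol; it gives a new state, a string replacing the topmost stack symbol (its first letter becomes
the new top), and an element of `W` saying what is written on the write-only tapes.
For a single write-only tape with alphabet `γ`, `W = Option γ`. -/
structure NPDA (α W : Type) where
  /-- inner states -/
  Q : Type
  /-- stack alphabet -/
  Θ : Type
  finite_Q : Finite Q
  finite_Θ : Finite Θ
  /-- transition function -/
  δ : Q → Option (InputSym α) → Θ → Set (Q × List Θ × W)
  finite_δ : ∀ q s Z, (δ q s Z).Finite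
  /-- initial state -/
  q₀ : Q
  /-- bottom marker -/
  Z₀ : Θ
  /-- accepting states -/
  acc : Set Q
  /-- rejecting states -/
  rej : Set Q
  disjoint_acc_rej : Disjoint acc rej

namespace NPDA

variable {α γ W : Type}

/-- The halting states. -/
def halt (N : NPDA α W) : Set N.Q := N.acc ∪ N.rej

/-- Configurations of an npda with an output tape. `input` is the part of the input tape that is
not yet read, the head of `stack` is its top. -/
structure Config (N : NPDA α (Option γ)) where
  state : N.Q
  input : List (InputSym α)
  stack : List N.Θ
  output : List γ

/-- The initial configuration on input `x`. -/
def start (N : NPDA α (Option γ)) (x : List α) : N.Config :=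
  ⟨N.q₀, inputTape x, [N.Z₀], []⟩

/-- One move of an npda with an output tape. -/
inductive Step (N : NPDA α (Option γ)) : N.Config → N.Config → Prop
  | read {q p : N.Q} {s : InputSym α} {u : List (InputSym α)} {Z : N.Θ} {v st : List N.Θ}
      {o : Option γ} {out : List γ} :
      q ∉ N.halt → (p, v, o) ∈ N.δ q (some s) Z →
      Step N ⟨q, s :: u, Z :: st, out⟩ ⟨p, u, v ++ st, out ++ o.toList⟩
  | lambda {q p : N.Q} {u : List (InputSym α)} {Z : N.Θ} {v st : List N.Θ}
      {o : Option γ} {out : List γ} :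
      q ∉ N.halt → (p, v, o) ∈ N.δ q none Z →
      Step N ⟨q, u, Z :: st, out⟩ ⟨p, u, v ++ st, out ++ o.toList⟩

/-- The termination condition: on inputs of length `n`, all computation paths reach halting states
in `O(n)` steps. -/
def LinearTime (N : NPDA α (Option γ)) : Prop :=
  ∃ a b : ℕ, ∀ x : List α,
    TerminatesWithin N.Step (fun c => c.state ∈ N.halt) (N.start x) (a * x.length + b)

/-- The set of valid outcomes on input `x`: those produced along accepting computation paths. -/
def outcomes (N : NPDA α (Option γ)) (x : List α) : Set (List γ) :=
  {y | ∃ c : N.Config, Relation.ReflTransGen N.Step (N.start x) c ∧ c.state ∈ N.acc ∧ c.output = y}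

end NPDA

/-! ### Oracle pushdown automata -/

/-- Oracle npda's with input alphabet `α`, query alphabet `β` and output alphabet `γ`: npda's with
two write-only tapes (output tape and query tape) and three special inner states. -/
structure OracleNPDA (α β γ : Type) extends NPDA α (Option γ × Option β) where
  query : Q
  yes : Q
  no : Q
  query_not_halt : query ∉ acc ∪ rej
  query_ne_yes : query ≠ yes
  query_ne_no : query ≠ no
  yes_ne_no : yes ≠ no

namespace OracleNPDA

variable {α β γ : Type}

/-- Configurations of an oracle npda; `queryTape` is the content of the query tape. -/
structure Config (M : OracleNPDA α β γ) where
  state : M.Q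
  input : List (InputSym α)
  stack : List M.Θ
  output : List γ
  queryTape : List β

/-- The initial configuration on input `x`. -/
def start (M : OracleNPDA α β γ) (x : List α) : M.Config :=
  ⟨M.q₀, inputTape x, [M.Z₀], [], []⟩

/-- One move of an oracle npda with oracle `A`. In the query state the content of the query tape is
sent to the oracle, the query tape is erased, and the state becomes `yes` or `no` according to the
answer. -/
inductive Step (M : OracleNPDA α β γ) (A : Language β) : M.Config → M.Config → Prop
  | read {q p : M.Q} {s : InputSym α} {u : List (InputSym α)} {Z : M.Θ} {v st : List M.Θ}
      {o : Option γ} {r : Option β} {out : List γ} {qt : List β} :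
      q ∉ M.halt → q ≠ M.query → (p, v, o, r) ∈ M.δ q (some s) Z →
      Step M A ⟨q, s :: u, Z :: st, out, qt⟩ ⟨p, u, v ++ st, out ++ o.toList, qt ++ r.toList⟩
  | lambda {q p : M.Q} {u : List (InputSym α)} {Z : M.Θ} {v st : List M.Θ}
      {o : Option γ} {r : Option β} {out : List γ} {qt : List β} :
      q ∉ M.halt → q ≠ M.query → (p, v, o, r) ∈ M.δ q none Z →
      Step M A ⟨q, u, Z :: st, out, qt⟩ ⟨p, u, v ++ st, out ++ o.toList, qt ++ r.toList⟩
  | answerYes {u : List (InputSym α)} {st : List M.Θ} {out : List γ} {qt : List β} :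
      qt ∈ A → Step M A ⟨M.query, u, st, out, qt⟩ ⟨M.yes, u, st, out, []⟩
  | answerNo {u : List (InputSym α)} {st : List M.Θ} {out : List γ} {qt : List β} :
      qt ∉ A → Step M A ⟨M.query, u, st, out, qt⟩ ⟨M.no, u, st, out, []⟩

/-- The termination condition: no matter what oracle is used, all computation paths on inputs of
length `n` reach halting states in `O(n)` steps. -/
def LinearTime (M : OracleNPDA α β γ) : Prop :=
  ∃ a b : ℕ, ∀ (B : Language β) (x : List α),
    TerminatesWithin (M.Step B) (fun c => c.state ∈ M.halt) (M.start x) (a * x.length + b)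

/-- The set of valid outcomes on input `x` with oracle `A`. -/
def outcomes (M : OracleNPDA α β γ) (A : Language β) (x : List α) : Set (List γ) :=
  {y | ∃ c : M.Config,
    Relation.ReflTransGen (M.Step A) (M.start x) c ∧ c.state ∈ M.acc ∧ c.output = y}

/-- `M` with oracle `A` accepts `x`: some computation path is accepting. -/
def Accepts (M : OracleNPDA α β γ) (A : Language β) (x : List α) : Prop :=
  ∃ c : M.Config, Relation.ReflTransGen (M.Step A) (M.start x) c ∧ c.state ∈ M.acc

end OracleNPDA

/-! ### The CFL hierarchy and the CFL function hierarchy -/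

/-- `CFL_T^A`: languages over `α` that are Turing reducible to `A` by oracle npda's. There is no
output tape, that is, the output alphabet is empty. -/
def CFLT {α β : Type} (A : Language β) : Set (Language α) :=
  {L | ∃ M : OracleNPDA α β Empty, M.LinearTime ∧ ∀ x, x ∈ L ↔ M.Accepts A x}

/-- The classes `Σ_k^CFL` (`k ≥ 1`) of languages over `α`: `Σ_1^CFL = CFL` and
`Σ_{k+1}^CFL = CFL_T(Π_k^CFL)`, where `A ∈ Π_k^CFL` iff the complement of `A` is in `Σ_k^CFL`.
The value at `0` is not used. -/
def SigmaCFL : ℕ → (α : Type) → Set (Language α)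
  | 0, _ => ∅
  | 1, _ => {L | L.IsContextFree}
  | k + 2, _ => {L | ∃ (β : Type) (_ : Finite β) (A : Language β),
      Aᶜ ∈ SigmaCFL (k + 1) β ∧ L ∈ CFLT A}

/-- `Π_k^CFL = co-Σ_k^CFL`. -/
def PiCFL (k : ℕ) (α : Type) : Set (Language α) := {A | Aᶜ ∈ SigmaCFL k α}

/-- `CFLMV`: multi-valued partial functions computed by npda's with output tapes. -/
def CFLMV (α γ : Type) : Set (List α → Set (List γ)) :=
  {f | ∃ N : NPDA α (Option γ), N.LinearTime ∧ ∀ x, f x = N.outcomes x}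

/-- `CFLMV_T^A`: functions computed by oracle npda's with oracle `A`. -/
def CFLMVT {α β γ : Type} (A : Language β) : Set (List α → Set (List γ)) :=
  {f | ∃ M : OracleNPDA α β γ, M.LinearTime ∧ ∀ x, f x = M.outcomes A x}

/-- `Σ_k^CFL MV` (`k ≥ 1`): `Σ_1^CFL MV = CFLMV` and `Σ_{k+1}^CFL MV = CFLMV_T(Π_k^CFL)`.
The value at `0` is not used. -/
def SigmaCFLMV : ℕ → (α γ : Type) → Set (List α → Set (List γ))
  | 0, _, _ => ∅
  | 1, α, γ => CFLMV α γ
  | k + 2, _, _ => {f | ∃ (β : Type) (_ : Finite β), ∃ A ∈ PiCFL (k + 1) β, f ∈ CFLMVT A}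

/-- `Σ_k^CFL SV`: the single-valued partial functions in `Σ_k^CFL MV`. -/
def SigmaCFLSV (k : ℕ) (α γ : Type) : Set (List α → Set (List γ)) :=
  {f | f ∈ SigmaCFLMV k α γ ∧ ∀ x, (f x).Subsingleton}

/-- `Σ_k^CFL SV_t`: the total functions in `Σ_k^CFL SV`. -/
def SigmaCFLSVt (k : ℕ) (α γ : Type) : Set (List α → Set (List γ)) :=
  {f | f ∈ SigmaCFLSV k α γ ∧ ∀ x, (f x).Nonempty}

/-! ### Deterministic multi-tape Turing machines -/

/-- Moves of a tape head. -/
inductive HeadMove : Type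
  | left : HeadMove
  | stay : HeadMove
  | right : HeadMove

/-- The displacement of a head move. -/
def HeadMove.shift : HeadMove → ℤ
  | left => -1
  | stay => 0
  | right => 1

/-- The two-way infinite tape with `w` in the cells `0, …, |w| - 1` and blanks elsewhere. -/
def wordTape {S : Type} (blank : S) (w : List S) : ℤ → S
  | Int.ofNat n => w.getD n blank
  | Int.negSucc _ => blank

/-- Deterministic multi-tape Turing machines with input alphabet `α` and output alphabet `γ`, both
identified with sets of nonblank tape symbols. The tapes are indexed by a finite type `ι` and are
two-way infinite; `δ q s = none` means that the machine halts. -/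
structure MultiTapeTM (α γ : Type) where
  /-- states -/
  Q : Type
  /-- tapes -/
  ι : Type
  /-- tape symbols -/
  S : Type
  finite_Q : Finite Q
  finite_ι : Finite ι
  finite_S : Finite S
  blank : S
  inSym : α → S
  inSym_injective : Function.Injective inSym
  inSym_ne_blank : ∀ a, inSym a ≠ blank
  outSym : γ → S
  outSym_injective : Function.Injective outSym
  outSym_ne_blank : ∀ a, outSym a ≠ blank
  inTape : ι
  outTape : ι
  q₀ : Q
  /-- transition function: new state, and symbol written and head move for every tape -/
  δ : Q → (ι → S) → Option (Q × (ι → S × HeadMove))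

namespace MultiTapeTM

variable {α γ : Type}

/-- Configurations: state, tape contents and head positions. -/
structure Config (M : MultiTapeTM α γ) where
  state : M.Q
  cells : M.ι → ℤ → M.S
  head : M.ι → ℤ

open Classical in
/-- The initial configuration: the input is on the input tape, all other tapes are blank, and all
heads are in cell `0`. -/
noncomputable def start (M : MultiTapeTM α γ) (x : List α) : M.Config where
  state := M.q₀
  cells i := if i = M.inTape then wordTape M.blank (x.map M.inSym) else fun _ => M.blank
  head _ := 0

/-- The next configuration, or `none` if the machine halts. -/
def step (M : MultiTapeTM α γ) (c : M.Config) : Option M.Config :=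
  (M.δ c.state fun i => c.cells i (c.head i)).map fun r =>
    { state := r.1
      cells := fun i => Function.update (c.cells i) (c.head i) (r.2 i).1
      head := fun i => c.head i + (r.2 i).2.shift }

/-- `c` occurs in the computation on input `x`. -/
def Reaches (M : MultiTapeTM α γ) (x : List α) (c : M.Config) : Prop :=
  Relation.ReflTransGen (fun c d => M.step c = some d) (M.start x) c

/-- On input `x` the machine halts, and then the output tape contains `y` and nothing else. -/
def Outputs (M : MultiTapeTM α γ) (x : List α) (y : List γ) : Prop :=
  ∃ c, M.Reaches x c ∧ M.step c = none ∧ c.cells M.outTape = wordTape M.blank (y.map M.outSym)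

/-- The cells of tape `i` that are scanned in the computation on input `x`. -/
def scanned (M : MultiTapeTM α γ) (x : List α) (i : M.ι) : Set ℤ :=
  {p | ∃ c, M.Reaches x c ∧ c.head i = p}

/-- The machine is `O(n)` space-bounded: on every input of length `n` it scans `O(n)` cells of each
of its tapes, input and output tape included. -/
def LinearSpace (M : MultiTapeTM α γ) : Prop :=
  ∃ a b : ℕ, ∀ (x : List α) (i : M.ι), (M.scanned x i).encard ≤ ((a * x.length + b : ℕ) : ℕ∞)

/-- The machine computes the single-valued total function `f`: on every input `x` it halts with the
unique value of `f` at `x` as its output. -/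
def Computes (M : MultiTapeTM α γ) (f : List α → Set (List γ)) : Prop :=
  ∀ x, ∃ y, f x = {y} ∧ M.Outputs x y

end MultiTapeTM

/-!
The behaviour of an oracle npda `M` running in time `a * n + b` is determined by the list of its
nondeterministic choices, a word of length at most `a * n + b` over a finite alphabet. These words
are enumerated by a counter in linear space; along a fixed one, `M` behaves deterministically, and
all of its tapes, the query tape included, have linear length. A query `s` therefore has length
`O(n)`, and an oracle decided in linear space answers it in space `O(|s|) = O(n)`, which is reused
for the next query. By induction on the level, every language of the hierarchy is decided in linear
space, and, for a single-valued total function, the first accepting list of choices that is found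
yields the value.

The induction starts with a context-free language. The pushdown automaton that guesses a leftmost
derivation need not halt in linear time, but it is enough that every word `w` of the language has an
accepting path of length `O(|w|)`, i.e. a derivation of length `O(|w|)`. To find one, erase symbols
that derive the empty word, and pass from a nonterminal to another one deriving the same word, in a
bounded number of steps; in between, the word splits into at least two shorter ones, which happens
fewer than `|w|` times.

Space is counted on stacks, on which programs compose as subroutines; a stack becomes a tape of a
Turing machine at the very end.
-/

/-! ### Programs working on several stacks -/

/-- The alphabets of two families of stacks side by side. -/
abbrev SumAlphabet {ι κ : Type} (Γ : ι → Type) (Δ : κ → Type) : ι ⊕ κ → Type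
  | .inl i => Γ i
  | .inr j => Δ j

instance {ι κ : Type} (Γ : ι → Type) (Δ : κ → Type) [∀ i, Finite (Γ i)] [∀ j, Finite (Δ j)] :
    ∀ s, Finite (SumAlphabet Γ Δ s)
  | .inl i => inferInstanceAs (Finite (Γ i))
  | .inr j => inferInstanceAs (Finite (Δ j))

/-- The contents of finitely many stacks, the stack `i` having the alphabet `Γ i`. The head of a
list is the top of the stack. -/
def Store {ι : Type} (Γ : ι → Type) : Type := ∀ i, List (Γ i)

namespace Store

variable {ι κ : Type} {Γ : ι → Type} {Δ : κ → Type}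

open scoped Classical in
/-- The store `σ` with the content of stack `i` replaced by `l`. -/
noncomputable def set (σ : Store Γ) (i : ι) (l : List (Γ i)) : Store Γ :=
  Function.update σ i l

/-- The store in which all stacks are empty. -/
def empty (Γ : ι → Type) : Store Γ := fun _ => []

/-- All stacks have height at most `L`. -/
def Fits (L : ℕ) (σ : Store Γ) : Prop := ∀ i, (σ i).length ≤ L

/-- Two stores side by side. -/
def sum (σ : Store Γ) (τ : Store Δ) : Store (SumAlphabet Γ Δ)
  | .inl i => σ i
  | .inr j => τ j

open scoped Classical in
@[simp]
theorem set_same (σ : Store Γ) (i : ι) (l : List (Γ i)) : σ.set i l i = l :=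
  Function.update_self ..

open scoped Classical in
theorem set_of_ne (σ : Store Γ) {i j : ι} (h : j ≠ i) (l : List (Γ i)) : σ.set i l j = σ j :=
  Function.update_of_ne h ..

open scoped Classical in
@[simp]
theorem set_eq_self (σ : Store Γ) (i : ι) : σ.set i (σ i) = σ :=
  Function.update_eq_self ..

theorem set_eq_self_of_eq {σ : Store Γ} {i : ι} {l : List (Γ i)} (h : σ i = l) :
    σ.set i l = σ := by
  rw [← h, set_eq_self]

open scoped Classical in
@[simp]
theorem set_set (σ : Store Γ) (i : ι) (l l' : List (Γ i)) : (σ.set i l).set i l' = σ.set i l' :=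
  Function.update_idem ..

open scoped Classical in
theorem set_comm (σ : Store Γ) {i j : ι} (h : i ≠ j) (l : List (Γ i)) (l' : List (Γ j)) :
    (σ.set i l).set j l' = (σ.set j l').set i l :=
  Function.update_comm h ..

@[simp]
theorem sum_inl (σ : Store Γ) (τ : Store Δ) (i : ι) : σ.sum τ (.inl i) = σ i := rfl

@[simp]
theorem sum_inr (σ : Store Γ) (τ : Store Δ) (j : κ) : σ.sum τ (.inr j) = τ j := rfl

theorem empty_sum_empty : (empty Γ).sum (empty Δ) = empty (SumAlphabet Γ Δ) := by
  funext s
  cases s <;> rfl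

@[simp]
theorem sum_set_inl (σ : Store Γ) (τ : Store Δ) (i : ι) (l : List (Γ i)) :
    (σ.sum τ).set (.inl i) l = (σ.set i l).sum τ := by
  funext j
  rcases eq_or_ne j (.inl i) with rfl | hj
  · exact (set_same ..).trans (set_same ..).symm
  · rw [set_of_ne _ hj]
    cases j with
    | inl j => exact (set_of_ne _ (by simpa using hj) _).symm
    | inr j => rfl

@[simp]
theorem sum_set_inr (σ : Store Γ) (τ : Store Δ) (i : κ) (l : List (Δ i)) :
    (σ.sum τ).set (.inr i) l = σ.sum (τ.set i l) := by
  funext j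
  rcases eq_or_ne j (.inr i) with rfl | hj
  · exact (set_same ..).trans (set_same ..).symm
  · rw [set_of_ne _ hj]
    cases j with
    | inl j => rfl
    | inr j => exact (set_of_ne _ (by simpa using hj) _).symm

theorem fits_empty (L : ℕ) : (empty Γ).Fits L := fun _ => Nat.zero_le _

theorem Fits.set {L : ℕ} {σ : Store Γ} (h : σ.Fits L) {i : ι} {l : List (Γ i)}
    (hl : l.length ≤ L) : (σ.set i l).Fits L := by
  intro j
  rcases eq_or_ne j i with rfl | hj
  · rwa [set_same]
  · rw [set_of_ne _ hj]
    exact h j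

theorem Fits.sum {L : ℕ} {σ : Store Γ} {τ : Store Δ} (hσ : σ.Fits L) (hτ : τ.Fits L) :
    (σ.sum τ).Fits L
  | .inl i => hσ i
  | .inr j => hτ j

theorem Fits.mono {L L' : ℕ} {σ : Store Γ} (h : σ.Fits L) (hL : L ≤ L') : σ.Fits L' :=
  fun i => (h i).trans hL

end Store

/-- Instructions of stack programs with control points `Q` and results `R`. -/
inductive StackInstr {ι : Type} (Γ : ι → Type) (Q R : Type) : Type
  | ret (r : R)
  | jump (q : Q)
  | push (i : ι) (s : Γ i) (q : Q)
  | pop (i : ι) (k : Option (Γ i) → Q)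

namespace StackInstr

variable {ι κ : Type} {Γ : ι → Type} {Q Q' R R' : Type}

/-- Rename the control points by `f`, and replace `ret r` by `g r`. -/
def subst (f : Q → Q') (g : R → StackInstr Γ Q' R') : StackInstr Γ Q R → StackInstr Γ Q' R'
  | ret r => g r
  | jump q => jump (f q)
  | push i s q => push i s (f q)
  | pop i k => pop i fun o => f (k o)

theorem subst_ret (x : StackInstr Γ Q R) : x.subst (fun q => q) .ret = x := by
  cases x <;> rfl

/-- Let the instruction work on the stacks `f i`. -/
def onStacks {Γ : ι → Type} {f : κ → ι} :
    StackInstr (fun j => Γ (f j)) Q R → StackInstr Γ Q R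
  | ret r => ret r
  | jump q => jump q
  | push i s q => push (f i) s q
  | pop i k => pop (f i) k

end StackInstr

/-- Deterministic programs that work on stacks and return an element of `R`. -/
structure StackProg {ι : Type} (Γ : ι → Type) (R : Type) where
  /-- control points -/
  Q : Type
  finite_Q : Finite Q
  q₀ : Q
  instr : Q → StackInstr Γ Q R

namespace StackProg

variable {ι κ : Type} {Γ : ι → Type} {Δ : κ → Type} {A B R : Type}

/-- One step of a program; `none` if it has returned. -/
noncomputable def next (P : StackProg Γ R) (c : P.Q × Store Γ) : Option (P.Q × Store Γ) :=
  match P.instr c.1 with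
  | .ret _ => none
  | .jump q => some (q, c.2)
  | .push i s q => some (q, c.2.set i (s :: c.2 i))
  | .pop i k => some (k (c.2 i).head?, c.2.set i (c.2 i).tail)

/-- `P.Path L c d`: the computation from `c` reaches `d`, the stacks having height at most `L`
after every step. -/
def Path (P : StackProg Γ R) (L : ℕ) : P.Q × Store Γ → P.Q × Store Γ → Prop :=
  Relation.ReflTransGen fun c d => P.next c = some d ∧ d.2.Fits L

/-- `P.Runs σ r τ L`: started with the store `σ`, the program returns `r` and leaves the store `τ`,
and the heights of the stacks never exceed `L`. -/
def Runs (P : StackProg Γ R) (σ : Store Γ) (r : R) (τ : Store Γ) (L : ℕ) : Prop :=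
  σ.Fits L ∧ ∃ q, P.Path L (P.q₀, σ) (q, τ) ∧ P.instr q = .ret r

theorem Path.fits {P : StackProg Γ R} {L : ℕ} {c d : P.Q × Store Γ} (h : P.Path L c d)
    (hc : c.2.Fits L) : d.2.Fits L := by
  rcases Relation.ReflTransGen.cases_tail h with rfl | ⟨e, -, -, he⟩
  exacts [hc, he]

theorem Runs.fits {P : StackProg Γ R} {σ τ : Store Γ} {r : R} {L : ℕ} (h : P.Runs σ r τ L) :
    τ.Fits L := by
  obtain ⟨hσ, q, hp, -⟩ := h
  exact hp.fits hσ

theorem Runs.mono {P : StackProg Γ R} {σ τ : Store Γ} {r : R} {L L' : ℕ} (h : P.Runs σ r τ L)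
    (hL : L ≤ L') : P.Runs σ r τ L' := by
  obtain ⟨hσ, q, hp, hq⟩ := h
  exact ⟨hσ.mono hL, q, Relation.ReflTransGen.mono (fun _ _ h => ⟨h.1, h.2.mono hL⟩) _ _ hp, hq⟩

/-- The program that returns `r` immediately. -/
def pure (Γ : ι → Type) (r : R) : StackProg Γ R where
  Q := Unit
  finite_Q := inferInstance
  q₀ := ()
  instr _ := .ret r

theorem runs_pure {σ : Store Γ} {r : R} {L : ℕ} (h : σ.Fits L) : (pure Γ r).Runs σ r σ L :=
  ⟨h, (), .refl, rfl⟩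

/-- Push `s` on stack `i`. -/
def push (i : ι) (s : Γ i) : StackProg Γ Unit where
  Q := Bool
  finite_Q := inferInstance
  q₀ := false
  instr b := bif b then .ret () else .push i s true

theorem runs_push {σ : Store Γ} {i : ι} {s : Γ i} {L : ℕ} (h : σ.Fits L)
    (hi : (σ i).length + 1 ≤ L) : (push i s).Runs σ () (σ.set i (s :: σ i)) L :=
  ⟨h, true, .single ⟨rfl, h.set (by simpa using hi)⟩, rfl⟩

/-- Pop the top of stack `i` and return it, or return `none` if the stack is empty. -/
def pop (i : ι) [Finite (Γ i)] : StackProg Γ (Option (Γ i)) where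
  Q := Option (Option (Γ i))
  finite_Q := inferInstance
  q₀ := none
  instr q := q.elim (.pop i some) .ret

theorem runs_pop {σ : Store Γ} {i : ι} [Finite (Γ i)] {L : ℕ} (h : σ.Fits L) :
    (pop i).Runs σ (σ i).head? (σ.set i (σ i).tail) L :=
  ⟨h, some (σ i).head?,
    .single ⟨rfl, h.set (by grind [h i])⟩, rfl⟩

/-- Run `P`, then `K a`, where `a` is the result of `P`. -/
def bind [Finite A] (P : StackProg Γ A) (K : A → StackProg Γ B) : StackProg Γ B where
  Q := P.Q ⊕ (Σ a, (K a).Q)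
  finite_Q := by
    have := P.finite_Q
    have := fun a => (K a).finite_Q
    infer_instance
  q₀ := .inl P.q₀
  instr := Sum.elim
    (fun q => (P.instr q).subst .inl fun a => .jump (.inr ⟨a, (K a).q₀⟩))
    (fun q => ((K q.1).instr q.2).subst (fun p => .inr ⟨q.1, p⟩) .ret)

theorem next_subst {P : StackProg Γ A} {P' : StackProg Γ B} {f : P.Q → P'.Q}
    {g : A → StackInstr Γ P'.Q B} (h : ∀ q, P'.instr (f q) = (P.instr q).subst f g)
    {c d : P.Q × Store Γ} (hcd : P.next c = some d) :
    P'.next (f c.1, c.2) = some (f d.1, d.2) := by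
  unfold next at hcd ⊢
  simp only [h]
  cases hi : P.instr c.1 <;> simp only [hi, Option.some.injEq, reduceCtorEq] at hcd
  all_goals subst hcd; simp [StackInstr.subst]

theorem Path.subst {P : StackProg Γ A} {P' : StackProg Γ B} {f : P.Q → P'.Q}
    {g : A → StackInstr Γ P'.Q B} (h : ∀ q, P'.instr (f q) = (P.instr q).subst f g) {L : ℕ}
    {c d : P.Q × Store Γ} (hcd : P.Path L c d) : P'.Path L (f c.1, c.2) (f d.1, d.2) :=
  Relation.ReflTransGen.lift (fun c : P.Q × Store Γ => (f c.1, c.2))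
    (fun _ _ h' => ⟨next_subst h h'.1, h'.2⟩) _ _ hcd

theorem Runs.bind [Finite A] {P : StackProg Γ A} {K : A → StackProg Γ B} {σ τ υ : Store Γ} {a : A}
    {b : B} {L : ℕ} (h : P.Runs σ a τ L) (hK : (K a).Runs τ b υ L) :
    (P.bind K).Runs σ b υ L := by
  obtain ⟨hσ, q, hp, hq⟩ := h
  obtain ⟨hτ, q', hp', hq'⟩ := hK
  have hfirst : (P.bind K).Path L (.inl P.q₀, σ) (.inl q, τ) := Path.subst (fun _ => rfl) hp
  have hjump : (P.bind K).next (.inl q, τ) = some (.inr ⟨a, (K a).q₀⟩, τ) := by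
    simp [next, StackProg.bind, hq, StackInstr.subst]
  have hsecond : (P.bind K).Path L (.inr ⟨a, (K a).q₀⟩, τ) (.inr ⟨a, q'⟩, υ) :=
    Path.subst (P' := P.bind K) (f := fun p => .inr ⟨a, p⟩) (fun _ => rfl) hp'
  exact ⟨hσ, .inr ⟨a, q'⟩, (hfirst.tail ⟨hjump, hτ⟩).trans hsecond,
    by simp [StackProg.bind, hq', StackInstr.subst]⟩

/-- Run `body a`; if it returns `inl a'`, continue with `a'`, if it returns `inr b`, return `b`. -/
def loop [Finite A] (body : A → StackProg Γ (A ⊕ B)) (a : A) : StackProg Γ B where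
  Q := Σ a, (body a).Q
  finite_Q := by
    have := fun a => (body a).finite_Q
    infer_instance
  q₀ := ⟨a, (body a).q₀⟩
  instr q := ((body q.1).instr q.2).subst (fun p => ⟨q.1, p⟩)
    (Sum.elim (fun a' => .jump ⟨a', (body a').q₀⟩) .ret)

theorem Runs.loop_done [Finite A] {body : A → StackProg Γ (A ⊕ B)} {a : A} {b : B}
    {σ τ : Store Γ} {L : ℕ} (h : (body a).Runs σ (.inr b) τ L) : (loop body a).Runs σ b τ L := by
  obtain ⟨hσ, q, hp, hq⟩ := h
  exact ⟨hσ, ⟨a, q⟩, Path.subst (P' := loop body a) (f := fun p => ⟨a, p⟩) (fun _ => rfl) hp,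
    by simp [loop, hq, StackInstr.subst]⟩

theorem Runs.loop_step [Finite A] {body : A → StackProg Γ (A ⊕ B)} {a a' : A} {b : B}
    {σ τ υ : Store Γ} {L : ℕ} (h : (body a).Runs σ (.inl a') τ L)
    (h' : (loop body a').Runs τ b υ L) : (loop body a).Runs σ b υ L := by
  obtain ⟨hσ, q, hp, hq⟩ := h
  obtain ⟨hτ, q', hp', hq'⟩ := h'
  have hfirst : (loop body a).Path L (⟨a, (body a).q₀⟩, σ) (⟨a, q⟩, τ) :=
    Path.subst (P' := loop body a) (f := fun p => ⟨a, p⟩) (fun _ => rfl) hp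
  have hjump : (loop body a).next (⟨a, q⟩, τ) = some (⟨a', (body a').q₀⟩, τ) := by
    simp [next, loop, hq, StackInstr.subst]
  have hsecond : (loop body a).Path L (⟨a', (body a').q₀⟩, τ) (q', υ) :=
    Path.subst (P := loop body a') (P' := loop body a) (fun _ => (StackInstr.subst_ret _).symm) hp'
  exact ⟨hσ, q', (hfirst.tail ⟨hjump, hτ⟩).trans hsecond, hq'⟩

/-- Let the program work on the stacks `f i`. -/
def onStacks {f : κ → ι} (P : StackProg (fun j => Γ (f j)) R) : StackProg Γ R where
  Q := P.Q
  finite_Q := P.finite_Q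
  q₀ := P.q₀
  instr q := (P.instr q).onStacks

theorem Runs.onStacks {f : κ → ι} {P : StackProg (fun j => Γ (f j)) R}
    {F : Store (fun j => Γ (f j)) → Store Γ} (hF : ∀ σ j, F σ (f j) = σ j)
    (hset : ∀ σ j l, (F σ).set (f j) l = F (σ.set j l)) {L : ℕ}
    (hfits : ∀ σ, Store.Fits L σ → (F σ).Fits L) {σ τ : Store fun j => Γ (f j)} {r : R}
    (h : P.Runs σ r τ L) : P.onStacks.Runs (F σ) r (F τ) L := by
  obtain ⟨hσ, q, hp, hq⟩ := h
  refine ⟨hfits σ hσ, q, Relation.ReflTransGen.lift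
      (fun c : P.Q × Store fun j => Γ (f j) => (c.1, F c.2))
      (fun c d h => ⟨?_, hfits _ h.2⟩) _ _ hp,
    by simp [StackProg.onStacks, hq, StackInstr.onStacks]⟩
  have hcd := h.1
  unfold next at hcd ⊢
  cases hi : P.instr c.1 <;> simp only [hi, Option.some.injEq, reduceCtorEq] at hcd
  all_goals
    subst hcd
    simp only [StackProg.onStacks, hi, StackInstr.onStacks, hset, hF]

/-- The same program in the presence of further stacks. -/
def onLeft (Δ : κ → Type) (P : StackProg Γ R) : StackProg (SumAlphabet Γ Δ) R :=
  onStacks (Γ := SumAlphabet Γ Δ) (f := Sum.inl) P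

theorem Runs.onLeft {P : StackProg Γ R} {σ σ' : Store Γ} {r : R} {L : ℕ} (h : P.Runs σ r σ' L)
    {τ : Store Δ} (hτ : τ.Fits L) : (P.onLeft Δ).Runs (σ.sum τ) r (σ'.sum τ) L :=
  Runs.onStacks (Γ := SumAlphabet Γ Δ) (f := Sum.inl) (F := fun σ => Store.sum σ τ)
    (fun _ _ => rfl) (fun σ => σ.sum_set_inl τ) (fun _ hσ => hσ.sum hτ) h

/-- The same program in the presence of further stacks. -/
def onRight (Γ : ι → Type) (P : StackProg Δ R) : StackProg (SumAlphabet Γ Δ) R :=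
  onStacks (Γ := SumAlphabet Γ Δ) (f := Sum.inr) P

theorem Runs.onRight {P : StackProg Δ R} {τ τ' : Store Δ} {r : R} {L : ℕ} (h : P.Runs τ r τ' L)
    {σ : Store Γ} (hσ : σ.Fits L) : (P.onRight Γ).Runs (σ.sum τ) r (σ.sum τ') L :=
  Runs.onStacks (Γ := SumAlphabet Γ Δ) (f := Sum.inr) (F := fun τ => σ.sum τ)
    (fun _ _ => rfl) (fun τ => σ.sum_set_inr τ) (fun _ hτ => hσ.sum hτ) h

/-- Pop the symbols of stack `i` one after the other, and run `body s` for every symbol `s`. -/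
def drain (i : ι) [Finite (Γ i)] (body : Γ i → StackProg Γ Unit) : StackProg Γ Unit :=
  loop (fun _ : Unit => (pop i).bind fun o =>
    o.elim (pure Γ (.inr ())) fun s => (body s).bind fun _ => pure Γ (.inl ())) ()

theorem runs_drain {i : ι} [Finite (Γ i)] {body : Γ i → StackProg Γ Unit} {L n : ℕ}
    {F : List (Γ i) → List (Γ i) → Store Γ} (hF : ∀ d l, F d l i = l)
    (hbody : ∀ d s l, d.length + l.length + 1 = n →
      (body s).Runs ((F d (s :: l)).set i l) () (F (s :: d) l) L)
    {d l : List (Γ i)} (hn : d.length + l.length = n) (hfits : (F d l).Fits L) :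
    (drain i body).Runs (F d l) () (F (l.reverse ++ d) []) L := by
  have hpop := runs_pop (i := i) hfits
  induction l generalizing d with
  | nil =>
    rw [hF, List.tail_nil, Store.set_eq_self_of_eq (hF d [])] at hpop
    exact Runs.loop_done (hpop.bind (runs_pure hfits))
  | cons s l ih =>
    rw [hF, List.head?_cons, List.tail_cons] at hpop
    have hs := hbody d s l hn
    have hrest := ih (d := s :: d) (by grind) hs.fits (runs_pop hs.fits)
    rw [List.reverse_cons, List.append_assoc, List.singleton_append]
    exact Runs.loop_step (hpop.bind (hs.bind (runs_pure hs.fits))) hrest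

/-- Empty the stack `i`. -/
def clear (i : ι) [Finite (Γ i)] : StackProg Γ Unit := drain i fun _ => pure Γ ()

theorem runs_clear {i : ι} [Finite (Γ i)] {σ : Store Γ} {L : ℕ} (hσ : σ.Fits L) :
    (clear i).Runs σ () (σ.set i []) L := by
  have h := runs_drain (body := fun _ => pure Γ ()) (L := L) (F := fun _ l => σ.set i l)
    (fun _ l => σ.set_same i l) (d := []) (l := σ i) (n := (σ i).length)
    (fun d s l hl => ?_) (by simp) (by rwa [σ.set_eq_self])
  · rwa [σ.set_eq_self] at h
  · rw [σ.set_set]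
    exact runs_pure (hσ.set (by have := hσ i; omega))

/-- Empty all stacks in a list. -/
def clearList [∀ i, Finite (Γ i)] : List ι → StackProg Γ Unit
  | [] => pure Γ ()
  | i :: l => (clear i).bind fun _ => clearList l

theorem runs_clearList [∀ i, Finite (Γ i)] (l : List ι) {σ : Store Γ} {L : ℕ} (hσ : σ.Fits L) :
    ∃ τ, (clearList l).Runs σ () τ L ∧ (∀ i ∈ l, τ i = []) ∧ ∀ i ∉ l, τ i = σ i := by
  induction l generalizing σ with
  | nil => exact ⟨σ, runs_pure hσ, by simp⟩
  | cons i l ih =>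
    have hi := runs_clear (i := i) hσ
    obtain ⟨τ, hτ, hmem, hnmem⟩ := ih hi.fits
    refine ⟨τ, hi.bind hτ, fun j hj => ?_, fun j hj => ?_⟩
    · by_cases hl : j ∈ l
      · exact hmem j hl
      · obtain rfl : j = i := by simpa [hl] using hj
        rw [hnmem j hl, σ.set_same]
    · rw [List.mem_cons, not_or] at hj
      rw [hnmem j hj.2, σ.set_of_ne hj.1]

/-- Empty all stacks. -/
noncomputable def clearAll (Γ : ι → Type) [Finite ι] [∀ i, Finite (Γ i)] : StackProg Γ Unit :=
  clearList (Set.toFinite (Set.univ : Set ι)).toFinset.toList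

theorem runs_clearAll [Finite ι] [∀ i, Finite (Γ i)] {σ : Store Γ} {L : ℕ} (hσ : σ.Fits L) :
    (clearAll Γ).Runs σ () (Store.empty Γ) L := by
  obtain ⟨τ, h, h', -⟩ := runs_clearList (Set.toFinite (Set.univ : Set ι)).toFinset.toList hσ
  obtain rfl : τ = Store.empty Γ := funext fun i => h' i (by simp)
  exact h

/-- Move the symbols of stack `i` one after the other to stack `j`, changing them by `f`. -/
def move (i j : ι) [Finite (Γ i)] (f : Γ i → Γ j) : StackProg Γ Unit :=
  drain i fun s => push j (f s)

theorem runs_move {i j : ι} (hij : i ≠ j) [Finite (Γ i)] (f : Γ i → Γ j) {σ : Store Γ} {L : ℕ}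
    (hσ : σ.Fits L) (hl : (σ i).length + (σ j).length ≤ L) :
    (move i j f).Runs σ () ((σ.set i []).set j (((σ i).map f).reverse ++ σ j)) L := by
  have h := runs_drain (body := fun s => push j (f s)) (L := L)
    (F := fun d l => (σ.set i l).set j (d.map f ++ σ j)) (d := []) (l := σ i) (n := (σ i).length)
    (fun d l => by rw [Store.set_of_ne _ hij, σ.set_same]) (fun d s l hn => ?_) (by simp)
    (by simpa using hσ)
  · simpa [move] using h
  · have hfits : ((σ.set i l).set j (d.map f ++ σ j)).Fits L :=
      (hσ.set (by omega)).set (by simp; omega)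
    have hpush := runs_push (i := j) (s := f s) hfits (by simp; omega)
    rw [Store.set_comm _ hij.symm, σ.set_set]
    simpa using hpush

/-- Push a list of symbols, the last one first. -/
def pushList (i : ι) : List (Γ i) → StackProg Γ Unit
  | [] => pure Γ ()
  | s :: v => (pushList i v).bind fun _ => push i s

theorem runs_pushList {i : ι} (v : List (Γ i)) {σ : Store Γ} {L : ℕ} (hσ : σ.Fits L)
    (hl : v.length + (σ i).length ≤ L) : (pushList i v).Runs σ () (σ.set i (v ++ σ i)) L := by
  induction v with
  | nil =>
    rw [List.nil_append, σ.set_eq_self]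
    exact runs_pure hσ
  | cons s v ih =>
    rw [List.length_cons] at hl
    have hv := ih (by omega)
    have hs := runs_push (i := i) (s := s) hv.fits
      (by rw [σ.set_same, List.length_append]; omega)
    rw [σ.set_same, σ.set_set] at hs
    exact hv.bind hs

end StackProg

/-! ### Stack programs as Turing machines -/

section WordTape

variable {S : Type} (b : S)

theorem wordTape_natCast (w : List S) (n : ℕ) : wordTape b w n = w.getD n b := rfl

theorem wordTape_nil : wordTape b [] = fun _ => b := by
  funext p
  cases p <;> simp [wordTape]

theorem update_wordTape_length (w : List S) (s : S) :
    Function.update (wordTape b w) w.length s = wordTape b (w ++ [s]) := by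
  funext p
  cases p with
  | ofNat n =>
    rcases eq_or_ne n w.length with rfl | hn
    · simp [wordTape_natCast]
    · rw [Function.update_of_ne (by simpa using hn)]
      simp only [wordTape, List.getD_eq_getElem?_getD]
      rcases lt_or_gt_of_ne hn with h | h
      · rw [List.getElem?_append_left h]
      · rw [List.getElem?_eq_none h.le, List.getElem?_eq_none (by simp; omega)]
  | negSucc n => exact Function.update_of_ne (by simp) ..

theorem update_wordTape_concat_length (w : List S) (s : S) :
    Function.update (wordTape b (w ++ [s])) w.length b = wordTape b w := by
  rw [← update_wordTape_length, Function.update_idem, Function.update_eq_iff]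
  exact ⟨by simp [wordTape_natCast], fun _ _ => rfl⟩

end WordTape

namespace MultiTapeTM

variable {α γ : Type} {M : MultiTapeTM α γ}

/-- The heads are in the cells `-1, …, L`. -/
def Config.HeadsWithin (L : ℕ) (c : M.Config) : Prop := ∀ i, c.head i ∈ Set.Icc (-1 : ℤ) L

/-- The machine reaches `d` from `c`, the heads being in the cells `-1, …, L` after every step. -/
def PathWithin (L : ℕ) : M.Config → M.Config → Prop :=
  Relation.ReflTransGen fun c d => M.step c = some d ∧ d.HeadsWithin L

theorem headsWithin_of_halts {L : ℕ} {c d e : M.Config} (hc : c.HeadsWithin L)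
    (h : PathWithin L c d) (hd : M.step d = none)
    (he : Relation.ReflTransGen (fun c d => M.step c = some d) c e) : e.HeadsWithin L := by
  induction h using Relation.ReflTransGen.head_induction_on with
  | refl =>
    rcases Relation.ReflTransGen.cases_head he with rfl | ⟨f, hf, -⟩
    · exact hc
    · simp [hd] at hf
  | head hstep _ ih =>
    rcases Relation.ReflTransGen.cases_head he with rfl | ⟨f, hf, hfe⟩
    · exact hc
    · obtain rfl := Option.some.inj (hstep.1.symm.trans hf)
      exact ih hstep.2 hfe

theorem encard_scanned_le {L : ℕ} {x : List α} {d : M.Config} (h : PathWithin L (M.start x) d)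
    (hd : M.step d = none) (i : M.ι) : (M.scanned x i).encard ≤ (L + 2 : ℕ) := by
  have hsub : M.scanned x i ⊆ Finset.Icc (-1 : ℤ) L := by
    rintro p ⟨c, hc, rfl⟩
    rw [Finset.coe_Icc]
    exact headsWithin_of_halts (fun _ => by simp [MultiTapeTM.start]) h hd hc i
  refine (Set.encard_le_encard hsub).trans ?_
  rw [Set.encard_coe_eq_coe_finsetCard, Int.card_Icc]
  exact_mod_cast (by omega)

end MultiTapeTM

/-- Stack programs that compute partial functions: the program finds its input on the stack `input`,
the last letter on top; it returns whether there is an output and leaves it on the stack `output`,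
again with the last letter on top. -/
structure StackTransducer (α γ : Type) where
  /-- names of the stacks -/
  ι : Type
  /-- stack alphabets -/
  Γ : ι → Type
  finite_ι : Finite ι
  finite_Γ : ∀ i, Finite (Γ i)
  prog : StackProg Γ Bool
  input : ι
  output : ι
  inSym : α → Γ input
  inSym_injective : Function.Injective inSym
  outSym : γ → Γ output
  outSym_injective : Function.Injective outSym

namespace StackTransducer

attribute [instance] finite_ι finite_Γ

variable {α γ : Type} (T : StackTransducer α γ)

/-- The initial store on input `x`. -/
noncomputable def start (x : List α) : Store T.Γ :=
  (Store.empty T.Γ).set T.input (x.reverse.map T.inSym)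

/-- Started with the store `σ`, the program yields the output `o`, with stacks of height at most
`L`. -/
def Outputs (σ : Store T.Γ) (o : Option (List γ)) (L : ℕ) : Prop :=
  ∃ τ, T.prog.Runs σ o.isSome τ L ∧ ∀ y ∈ o, τ T.output = y.reverse.map T.outSym

/-- The symbols of the Turing machine. -/
abbrev TapeSym : Type := Option (Σ i, T.Γ i)

/-- The tape that represents the stack `i` with content `l`, the bottom of the stack in cell `0`. -/
def stackTape (i : T.ι) (l : List (T.Γ i)) : ℤ → T.TapeSym :=
  wordTape none (l.reverse.map fun g => some ⟨i, g⟩)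

open scoped Classical in
/-- The symbol of stack `i` in a cell, if there is one. -/
noncomputable def decode (i : T.ι) (s : T.TapeSym) : Option (T.Γ i) :=
  s.bind fun g => if h : g.1 = i then some (h ▸ g.2) else none

open scoped Classical in
/-- The action that writes `w` and makes the move `m` on tape `i`, and nothing elsewhere. -/
noncomputable def actOn (s : T.ι → T.TapeSym) (i : T.ι) (w : T.TapeSym) (m : HeadMove) :
    T.ι → T.TapeSym × HeadMove :=
  Function.update (fun j => (s j, .stay)) i (w, m)

/-- The transition function of the Turing machine that runs `T`. In the state `none` the input is
scanned up to its end. The state `some (q, false)` corresponds to the control point `q`, where each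
head is on the top of its stack, in cell `-1` if the stack is empty. A push takes two steps, and
`some (q, true)` is the state between them. -/
noncomputable def delta : Option (T.prog.Q × Bool) → (T.ι → T.TapeSym) →
    Option (Option (T.prog.Q × Bool) × (T.ι → T.TapeSym × HeadMove))
  | none, s =>
    if s T.input = none then some (some (T.prog.q₀, false), fun j => (s j, .left))
    else some (none, T.actOn s T.input (s T.input) .right)
  | some (q, false), s =>
    match T.prog.instr q with
    | .ret _ => none
    | .jump p => some (some (p, false), fun j => (s j, .stay))
    | .push i _ _ => some (some (q, true), T.actOn s i (s i) .right)
    | .pop i k => some (some (k (T.decode i (s i)), false),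
        T.actOn s i none (if s i = none then .stay else .left))
  | some (q, true), s =>
    match T.prog.instr q with
    | .push i g p => some (some (p, false), T.actOn s i (some ⟨i, g⟩) .stay)
    | _ => none

/-- The Turing machine that runs `T`. -/
noncomputable abbrev toTM : MultiTapeTM α γ where
  Q := Option (T.prog.Q × Bool)
  ι := T.ι
  S := T.TapeSym
  finite_Q := have := T.prog.finite_Q; inferInstance
  finite_ι := inferInstance
  finite_S := inferInstance
  blank := none
  inSym a := some ⟨T.input, T.inSym a⟩
  inSym_injective a b h := T.inSym_injective (by simpa using h)
  inSym_ne_blank a := Option.some_ne_none _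
  outSym a := some ⟨T.output, T.outSym a⟩
  outSym_injective a b h := T.outSym_injective (by simpa using h)
  outSym_ne_blank a := Option.some_ne_none _
  inTape := T.input
  outTape := T.output
  q₀ := none
  δ := T.delta

/-- The configuration of the Turing machine that corresponds to a configuration of the program. -/
def toConfig (c : T.prog.Q × Store T.Γ) : T.toTM.Config where
  state := some (c.1, false)
  cells i := T.stackTape i (c.2 i)
  head i := (c.2 i).length - 1

variable {T}

theorem stackTape_top (i : T.ι) (l : List (T.Γ i)) :
    T.stackTape i l (l.length - 1) = l.head?.map (Sigma.mk i) := by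
  cases l with
  | nil => rfl
  | cons g l => simp [stackTape, wordTape_natCast]

theorem update_stackTape_push (i : T.ι) (g : T.Γ i) (l : List (T.Γ i)) :
    Function.update (T.stackTape i l) l.length (some ⟨i, g⟩) = T.stackTape i (g :: l) := by
  simpa [stackTape] using update_wordTape_length (none : T.TapeSym)
    (l.reverse.map fun g => some ⟨i, g⟩) (some ⟨i, g⟩)

theorem update_stackTape_pop (i : T.ι) (l : List (T.Γ i)) :
    Function.update (T.stackTape i l) (l.length - 1) none = T.stackTape i l.tail := by
  cases l with
  | nil => exact Function.update_eq_self (-1 : ℤ) (T.stackTape i [])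
  | cons g l =>
    simpa [stackTape] using
      update_wordTape_concat_length (none : T.TapeSym) (l.reverse.map fun g => some ⟨i, g⟩)
        (some ⟨i, g⟩)

theorem decode_map_mk (i : T.ι) (o : Option (T.Γ i)) : T.decode i (o.map (Sigma.mk i)) = o := by
  cases o <;> simp [decode]

theorem step_of_delta {q q' : Option (T.prog.Q × Bool)} {cells : T.ι → ℤ → T.TapeSym}
    {head : T.ι → ℤ} {a : T.ι → T.TapeSym × HeadMove}
    (h : T.delta q (fun i => cells i (head i)) = some (q', a)) :
    T.toTM.step ⟨q, cells, head⟩ = some ⟨q', fun i => Function.update (cells i) (head i) (a i).1,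
      fun i => head i + (a i).2.shift⟩ :=
  congrArg (Option.map _) h

open scoped Classical in
theorem step_of_delta_actOn {q q' : Option (T.prog.Q × Bool)} {cells : T.ι → ℤ → T.TapeSym}
    {head : T.ι → ℤ} {i : T.ι} {w : T.TapeSym} {m : HeadMove}
    (h : T.delta q (fun i => cells i (head i))
      = some (q', T.actOn (fun i => cells i (head i)) i w m)) :
    T.toTM.step ⟨q, cells, head⟩ = some ⟨q',
      Function.update cells i (Function.update (cells i) (head i) w),
      Function.update head i (head i + m.shift)⟩ := by
  rw [step_of_delta h]
  congr 2 <;> refine funext fun j : T.ι => ?_ <;> rcases eq_or_ne j i with rfl | hj <;>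
    simp [actOn, HeadMove.shift, *]

open scoped Classical in
theorem toConfig_set (q : T.prog.Q) (σ : Store T.Γ) (i : T.ι) (l : List (T.Γ i)) :
    T.toConfig (q, σ.set i l) = ⟨some (q, false),
      Function.update (fun j => T.stackTape j (σ j)) i (T.stackTape i l),
      Function.update (fun j => ((σ j).length - 1 : ℤ)) i (l.length - 1)⟩ := by
  unfold toConfig
  congr 1 <;> refine funext fun j : T.ι => ?_ <;> rcases eq_or_ne j i with rfl | hj <;>
    simp [Store.set_of_ne, *]

theorem headsWithin_toConfig {L : ℕ} {c : T.prog.Q × Store T.Γ} (h : c.2.Fits L) :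
    (T.toConfig c).HeadsWithin L := by
  intro i
  have := h i
  simp only [toConfig, Set.mem_Icc]
  omega

theorem pathWithin_of_jump {L : ℕ} {q p : T.prog.Q} {σ : Store T.Γ} (hσ : σ.Fits L)
    (hq : T.prog.instr q = .jump p) :
    T.toTM.PathWithin L (T.toConfig (q, σ)) (T.toConfig (p, σ)) := by
  refine .single ⟨(step_of_delta (by simp only [delta, hq]; rfl)).trans ?_,
    headsWithin_toConfig hσ⟩
  simp [toConfig, HeadMove.shift]

theorem pathWithin_of_pop {L : ℕ} {q : T.prog.Q} {i : T.ι} {k : Option (T.Γ i) → T.prog.Q}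
    {σ : Store T.Γ} (hq : T.prog.instr q = .pop i k) (hσ : (σ.set i (σ i).tail).Fits L) :
    T.toTM.PathWithin L (T.toConfig (q, σ))
      (T.toConfig (k (σ i).head?, σ.set i (σ i).tail)) := by
  refine .single ⟨?_, headsWithin_toConfig hσ⟩
  refine (step_of_delta_actOn
    (by simp only [delta, hq, stackTape_top, decode_map_mk]; rfl)).trans ?_
  rw [toConfig_set, update_stackTape_pop]
  congr 3
  cases hi : σ i <;> simp [hi, HeadMove.shift, sub_eq_add_neg]

theorem pathWithin_of_push {L : ℕ} {q p : T.prog.Q} {i : T.ι} {g : T.Γ i} {σ : Store T.Γ}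
    (hq : T.prog.instr q = .push i g p) (hσ : (σ.set i (g :: σ i)).Fits L) :
    T.toTM.PathWithin L (T.toConfig (q, σ)) (T.toConfig (p, σ.set i (g :: σ i))) := by
  classical
  let mid : T.toTM.Config := ⟨some (q, true), fun j => T.stackTape j (σ j),
    (T.toConfig (p, σ.set i (g :: σ i))).head⟩
  have hright : T.toTM.step (T.toConfig (q, σ)) = some mid := by
    refine (step_of_delta_actOn (by simp only [delta, hq]; rfl)).trans ?_
    simp [mid, toConfig_set, HeadMove.shift]
  have hwrite : T.toTM.step mid = some (T.toConfig (p, σ.set i (g :: σ i))) := by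
    refine (step_of_delta_actOn (by simp only [delta, hq]; rfl)).trans ?_
    simp [toConfig_set, HeadMove.shift, update_stackTape_push]
  have hmid := headsWithin_toConfig (c := (p, σ.set i (g :: σ i))) hσ
  exact .tail (.single ⟨hright, hmid⟩) ⟨hwrite, hmid⟩

theorem pathWithin_of_next {L : ℕ} {c d : T.prog.Q × Store T.Γ} (hcd : T.prog.next c = some d)
    (hd : d.2.Fits L) : T.toTM.PathWithin L (T.toConfig c) (T.toConfig d) := by
  obtain ⟨q, σ⟩ := c
  unfold StackProg.next at hcd
  cases hq : T.prog.instr q <;> simp only [hq, Option.some.injEq, reduceCtorEq] at hcd <;>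
    subst hcd
  exacts [pathWithin_of_jump hd hq, pathWithin_of_push hq hd, pathWithin_of_pop hq hd]

theorem pathWithin_of_path {L : ℕ} {c d : T.prog.Q × Store T.Γ} (hcd : T.prog.Path L c d) :
    T.toTM.PathWithin L (T.toConfig c) (T.toConfig d) := by
  induction hcd with
  | refl => exact .refl
  | tail _ hstep ih => exact ih.trans (pathWithin_of_next hstep.1 hstep.2)

open scoped Classical in
theorem toTM_start_eq (x : List α) :
    T.toTM.start x = ⟨none, fun i => T.stackTape i (T.start x i), fun _ => 0⟩ := by
  unfold MultiTapeTM.start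
  congr 1
  refine funext fun i : T.ι => ?_
  rcases eq_or_ne i T.input with rfl | hi
  · simp [start, stackTape, Function.comp_def]
  · simpa [hi, start, Store.set_of_ne _ hi, stackTape, Store.empty] using
      (wordTape_nil (none : T.TapeSym)).symm

open scoped Classical in
theorem pathWithin_scan {L : ℕ} {x : List α} (hx : x.length ≤ L) {n : ℕ} (hn : n ≤ x.length) :
    T.toTM.PathWithin L (T.toTM.start x) ⟨none, fun i => T.stackTape i (T.start x i),
      Function.update (fun _ => 0) T.input (n : ℤ)⟩ := by
  induction n with
  | zero =>
    rw [toTM_start_eq, Nat.cast_zero, Function.update_eq_self T.input fun _ : T.ι => (0 : ℤ)]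
    exact .refl
  | succ n ih =>
    have hletter : T.stackTape T.input (T.start x T.input) n ≠ none := by
      simp [start, stackTape, wordTape_natCast, List.getD_eq_getElem?_getD,
        List.getElem?_eq_getElem (show n < x.length by omega)]
    refine (ih (by omega)).tail ⟨(step_of_delta_actOn
      (by simp only [delta, Function.update_self, if_neg hletter]; rfl)).trans ?_, fun i => ?_⟩
    · simp [HeadMove.shift]
    · rcases eq_or_ne i T.input with rfl | hi
      · simp only [Function.update_self, Set.mem_Icc]
        omega
      · simp [hi]

theorem pathWithin_start {L : ℕ} {x : List α} (hx : x.length ≤ L) :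
    T.toTM.PathWithin L (T.toTM.start x) (T.toConfig (T.prog.q₀, T.start x)) := by
  classical
  have hstart : (T.start x).Fits L := (Store.fits_empty L).set (by simpa using hx)
  have hblank : T.stackTape T.input (T.start x T.input) x.length = none := by
    simp [start, stackTape, wordTape_natCast]
  refine (pathWithin_scan hx le_rfl).tail ⟨(step_of_delta
    (by simp only [delta, Function.update_self, if_pos hblank]; rfl)).trans ?_,
    headsWithin_toConfig hstart⟩
  rw [start, toConfig_set]
  congr 2 <;> refine funext fun i : T.ι => ?_ <;> rcases eq_or_ne i T.input with rfl | hi <;>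
    simp [HeadMove.shift, Store.set_of_ne, Store.empty, sub_eq_add_neg, *]

theorem toTM_outputs {x : List α} {y : List γ} {L : ℕ} (h : T.Outputs (T.start x) (some y) L) :
    T.toTM.Outputs x y ∧ ∀ i, (T.toTM.scanned x i).encard ≤ (L + 2 : ℕ) := by
  obtain ⟨τ, ⟨hσ, q, hp, hq⟩, hy⟩ := h
  have hx : x.length ≤ L := by simpa [start] using hσ T.input
  have hpath := (pathWithin_start hx).trans (pathWithin_of_path hp)
  have hhalt : T.toTM.step (T.toConfig (q, τ)) = none := by
    simp [MultiTapeTM.step, toConfig, delta, hq]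
  refine ⟨⟨_, Relation.ReflTransGen.mono (fun _ _ h => h.1) _ _ hpath, hhalt, ?_⟩,
    MultiTapeTM.encard_scanned_le hpath hhalt⟩
  simp [toConfig, hy y rfl, stackTape, Function.comp_def]

theorem exists_multiTapeTM_of_outputs (T : StackTransducer α γ) {f : List α → Set (List γ)}
    {a b : ℕ} (h : ∀ x, ∃ y, f x = {y} ∧ T.Outputs (T.start x) (some y) (a * x.length + b)) :
    ∃ M : MultiTapeTM α γ, M.LinearSpace ∧ M.Computes f := by
  refine ⟨T.toTM, ⟨a, b + 2, fun x => ?_⟩, fun x => ?_⟩ <;> obtain ⟨y, hfx, hy⟩ := h x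
  exacts [(toTM_outputs hy).2, ⟨y, hfx, (toTM_outputs hy).1⟩]

end StackTransducer

/-! ### Exhaustive search -/

namespace Odometer

variable {m : ℕ}

/-- The successor of a list of digits, the least significant digit coming first; `none` if all
digits are maximal. -/
def succ : List (Fin (m + 1)) → Option (List (Fin (m + 1)))
  | [] => none
  | d :: l => d.lastCases ((succ l).map (0 :: ·)) fun i => some (i.succ :: l)

theorem succ_castSucc_cons (i : Fin m) (l : List (Fin (m + 1))) :
    succ (i.castSucc :: l) = some (i.succ :: l) :=
  Fin.lastCases_castSucc ..

theorem succ_last_cons (l : List (Fin (m + 1))) :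
    succ (Fin.last m :: l) = (succ l).map (0 :: ·) :=
  Fin.lastCases_last ..

theorem forall_of_succ {n : ℕ} {p : List (Fin (m + 1)) → Prop} (zero : p (List.replicate n 0))
    (step : ∀ l l', succ l = some l' → p l → p l') {l : List (Fin (m + 1))} (hl : l.length = n) :
    p l := by
  induction n generalizing p l with
  | zero => rwa [List.eq_nil_of_length_eq_zero hl]
  | succ n ih =>
    have hdigit (k : List (Fin (m + 1))) (h : p (0 :: k)) (d : Fin (m + 1)) : p (d :: k) := by
      induction d using Fin.induction with
      | zero => exact h
      | succ i hi => exact step _ _ (succ_castSucc_cons i k) hi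
    obtain _ | ⟨d, k⟩ := l
    · simp at hl
    refine hdigit k (ih (p := fun k => p (0 :: k)) zero (fun k k' hk h => ?_) (by simpa using hl)) d
    exact step _ _ (by rw [succ_last_cons, hk, Option.map_some]) (hdigit k h (Fin.last m))

@[elab_as_elim]
theorem forall_of_forall_succ {n : ℕ} {p : List (Fin (m + 1)) → Prop}
    (step : ∀ l, l.length = n → (∀ l', succ l = some l' → p l') → p l) {l : List (Fin (m + 1))}
    (hl : l.length = n) : p l := by
  induction n generalizing p l with
  | zero => exact step l hl (by simp [List.eq_nil_of_length_eq_zero hl, succ])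
  | succ n ih =>
    have hdigit (k : List (Fin (m + 1))) (hk : k.length = n) (h : p (Fin.last m :: k))
        (d : Fin (m + 1)) : p (d :: k) := by
      induction d using Fin.reverseInduction with
      | last => exact h
      | cast i hi => exact step _ (by simpa using hk) (by simpa [succ_castSucc_cons] using hi)
    obtain _ | ⟨d, k⟩ := l
    · simp at hl
    refine ih (p := fun k => ∀ d, p (d :: k)) (fun k hk h => hdigit k hk ?_) (by simpa using hl) d
    refine step _ (by simpa using hk) fun l' hl' => ?_
    rw [succ_last_cons] at hl'
    obtain ⟨k', hk', rfl⟩ := Option.map_eq_some_iff.1 hl'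
    exact h k' hk' 0

end Odometer

namespace StackProg

variable {ι : Type} {Γ : ι → Type}

/-- Move the symbols of stack `t` one after the other both to stack `i` and to stack `j`, changing
them by `f` and `g`. -/
def fork (t i j : ι) [Finite (Γ t)] (f : Γ t → Γ i) (g : Γ t → Γ j) : StackProg Γ Unit :=
  drain t fun s => (push i (f s)).bind fun _ => push j (g s)

theorem runs_fork {t i j : ι} (hti : t ≠ i) (htj : t ≠ j) (hij : i ≠ j) [Finite (Γ t)]
    (f : Γ t → Γ i) (g : Γ t → Γ j) {σ : Store Γ} {L : ℕ} (hσ : σ.Fits L)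
    (hi : (σ t).length + (σ i).length ≤ L) (hj : (σ t).length + (σ j).length ≤ L) :
    (fork t i j f g).Runs σ () (((σ.set t []).set i (((σ t).map f).reverse ++ σ i)).set j
      (((σ t).map g).reverse ++ σ j)) L := by
  have h := runs_drain (body := fun s => (push i (f s)).bind fun _ => push j (g s)) (L := L)
    (F := fun d l => ((σ.set t l).set i (d.map f ++ σ i)).set j (d.map g ++ σ j))
    (d := []) (l := σ t) (n := (σ t).length)
    (fun d l => by rw [Store.set_of_ne _ htj, Store.set_of_ne _ hti, σ.set_same])
    (fun d s l hn => ?_) (by simp) (by simpa using hσ)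
  · simpa [fork] using h
  · have hfits : (((σ.set t l).set i (d.map f ++ σ i)).set j (d.map g ++ σ j)).Fits L :=
      ((hσ.set (by omega)).set (by simp; omega)).set (by simp; omega)
    have hpush := runs_push (i := i) (s := f s) hfits
      (by rw [Store.set_of_ne _ hij, Store.set_same]; simp; omega)
    have hpush' := runs_push (i := j) (s := g s) hpush.fits
      (by rw [Store.set_of_ne _ hij.symm, Store.set_same]; simp; omega)
    rw [Store.set_comm _ htj.symm, Store.set_comm _ hti.symm, σ.set_set]
    convert hpush.bind (K := fun _ => push j (g s)) hpush' using 1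
    simp [Store.set_of_ne _ hij, Store.set_of_ne _ hij.symm, Store.set_comm _ hij.symm]

end StackProg

/-- The stacks of an exhaustive search: the input, the current list of digits, and copies that are
needed to restore them. -/
inductive SearchStack
  | input
  | inputCopy
  | digits
  | digitsCopy

namespace SearchStack

instance : Finite SearchStack :=
  Finite.of_injective (fun
    | input => (0 : Fin 4)
    | inputCopy => 1
    | digits => 2
    | digitsCopy => 3) (by rintro (_ | _ | _ | _) (_ | _ | _ | _) h <;> simp_all)

/-- The alphabets of the stacks of an exhaustive search. -/
abbrev Alphabet (S : Type) (m : ℕ) : SearchStack → Type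
  | input => S
  | inputCopy => S
  | digits => Fin (m + 1)
  | digitsCopy => Fin (m + 1)

instance (S : Type) (m : ℕ) [Finite S] : ∀ i, Finite (Alphabet S m i)
  | input => inferInstanceAs (Finite S)
  | inputCopy => inferInstanceAs (Finite S)
  | digits => inferInstanceAs (Finite (Fin (m + 1)))
  | digitsCopy => inferInstanceAs (Finite (Fin (m + 1)))

variable {S : Type} {m : ℕ}

/-- The store of an exhaustive search. -/
def store (w wc : List S) (l lc : List (Fin (m + 1))) : Store (Alphabet S m)
  | input => w
  | inputCopy => wc
  | digits => l
  | digitsCopy => lc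

variable (w wc v : List S) (l lc k : List (Fin (m + 1)))

@[simp]
theorem store_set_input : (store w wc l lc).set input v = store v wc l lc := by
  funext i
  cases i <;> first | exact Store.set_same .. | exact Store.set_of_ne _ (by simp) _

@[simp]
theorem store_set_inputCopy : (store w wc l lc).set inputCopy v = store w v l lc := by
  funext i
  cases i <;> first | exact Store.set_same .. | exact Store.set_of_ne _ (by simp) _

@[simp]
theorem store_set_digits : (store w wc l lc).set digits k = store w wc k lc := by
  funext i
  cases i <;> first | exact Store.set_same .. | exact Store.set_of_ne _ (by simp) _

@[simp]
theorem store_set_digitsCopy : (store w wc l lc).set digitsCopy k = store w wc l k := by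
  funext i
  cases i <;> first | exact Store.set_same .. | exact Store.set_of_ne _ (by simp) _

theorem store_nil : store [] [] [] [] = Store.empty (Alphabet S m) := by
  funext i
  cases i <;> rfl

theorem fits_store {w wc : List S} {l lc : List (Fin (m + 1))} {L : ℕ} (hw : w.length ≤ L)
    (hwc : wc.length ≤ L) (hl : l.length ≤ L) (hlc : lc.length ≤ L) :
    (store w wc l lc).Fits L
  | input => hw
  | inputCopy => hwc
  | digits => hl
  | digitsCopy => hlc

end SearchStack

namespace StackProg

open SearchStack

section Search

variable {S : Type} {m : ℕ}

/-- Write `a * n + b` zeros on the stack of digits, `n` being the length of the input. -/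
def initDigits (S : Type) [Finite S] (m a b : ℕ) : StackProg (SearchStack.Alphabet S m) Unit :=
  (pushList digits (List.replicate b (0 : Fin (m + 1)))).bind fun _ =>
  (drain input fun s : S => (push inputCopy s).bind fun _ =>
    pushList digits (List.replicate a (0 : Fin (m + 1)))).bind fun _ =>
  move inputCopy input fun s : S => s

theorem runs_initDigits [Finite S] (m : ℕ) {a b L : ℕ} {w : List S} (hw : w.length ≤ L)
    (hL : a * w.length + b ≤ L) :
    (initDigits S m a b).Runs (store w [] [] []) ()
      (store w [] (List.replicate (a * w.length + b) 0) []) L := by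
  have hb := runs_pushList (i := digits) (L := L) (σ := store w [] [] [])
    (List.replicate b (0 : Fin (m + 1))) (fits_store hw (by simp) (by simp) (by simp))
    (by simp [store]; omega)
  have hdrain := runs_drain (i := input) (L := L) (n := w.length) (d := []) (l := w)
    (body := fun s : S => (push inputCopy s).bind fun _ =>
      pushList digits (List.replicate a (0 : Fin (m + 1))))
    (F := fun d v => store v d (List.replicate (a * d.length + b) (0 : Fin (m + 1))) [])
    (fun _ _ => rfl) (fun d s v hn => ?_) (by simp) ?_
  · have hmove := runs_move (i := inputCopy) (j := input) (by simp) (fun s : S => s) hdrain.fits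
      (by simpa [store] using hw)
    refine Runs.bind (by simpa [store] using hb) (hdrain.bind ?_)
    simpa [store] using hmove
  · have hlen : a * (d.length + 1) + b ≤ L :=
      le_trans (by gcongr; omega) hL
    have hfits : (store v d (List.replicate (a * d.length + b) (0 : Fin (m + 1))) []).Fits L :=
      fits_store (by omega) (by omega) (by simp; lia) (by simp)
    have hpush := runs_push (i := inputCopy) (s := s) hfits (by simp only [store]; omega)
    have hzeros := runs_pushList (i := digits) (List.replicate a (0 : Fin (m + 1))) hpush.fits
      (by simp [store]; lia)
    rw [store_set_input]
    convert hpush.bind (K := fun _ => pushList digits (List.replicate a (0 : Fin (m + 1))))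
      hzeros using 1
    simp only [store_set_inputCopy, store_set_digits, store, List.replicate_append_replicate]
    congr 2
    simp only [List.length_cons]
    ring
  · exact fits_store hw (by simp) (by simp; omega) (by simp)

/-- Replace the first digit by its successor, or move a zero to the stack `digitsCopy` if the first
digit is maximal, which means that the carry has to be continued. -/
def carryStep (S : Type) (m : ℕ) : StackProg (SearchStack.Alphabet S m) (Unit ⊕ Bool) :=
  (pop digits).bind fun o => o.elim (pure _ (.inr false)) fun d : Fin (m + 1) => d.lastCases
    ((push digitsCopy (0 : Fin (m + 1))).bind fun _ => pure _ (.inl ()))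
    fun i => (push digits i.succ).bind fun _ => pure _ (.inr true)

theorem runs_carryStep_last {w : List S} {l lc : List (Fin (m + 1))} {L : ℕ}
    (h : (store w [] (Fin.last m :: l) lc).Fits L) (hlc : lc.length + 1 ≤ L) :
    (carryStep S m).Runs (store w [] (Fin.last m :: l) lc) (.inl ())
      (store w [] l (0 :: lc)) L := by
  have hpop := runs_pop (i := digits) h
  rw [store_set_digits] at hpop
  have hpush := runs_push (i := digitsCopy) (s := (0 : Fin (m + 1))) hpop.fits hlc
  refine hpop.bind ?_
  simp only [store, List.head?_cons, Option.elim_some, Fin.lastCases_last]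
  exact hpush.bind (by simpa using! runs_pure hpush.fits)

theorem runs_carryStep_castSucc {w : List S} {i : Fin m} {l lc : List (Fin (m + 1))} {L : ℕ}
    (h : (store w [] (i.castSucc :: l) lc).Fits L) :
    (carryStep S m).Runs (store w [] (i.castSucc :: l) lc) (.inr true)
      (store w [] (i.succ :: l) lc) L := by
  have hpop := runs_pop (i := digits) h
  rw [store_set_digits] at hpop
  have hpush := runs_push (i := digits) (s := i.succ) hpop.fits (h digits)
  refine hpop.bind ?_
  simp only [store, List.head?_cons, Option.elim_some, Fin.lastCases_castSucc]
  exact hpush.bind (by simpa using! runs_pure hpush.fits)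

/-- Replace the list of digits by its successor; the result is whether there is one. -/
def increment (S : Type) (m : ℕ) : StackProg (SearchStack.Alphabet S m) Bool :=
  (loop (fun _ : Unit => carryStep S m) ()).bind fun r =>
  (move digitsCopy digits fun d : Fin (m + 1) => d).bind fun _ => pure _ r

theorem runs_carry {w : List S} {L : ℕ} {l lc : List (Fin (m + 1))}
    (h : (store w [] l lc).Fits L) (hL : l.length + lc.length ≤ L) :
    ∃ k kc, (loop (fun _ : Unit => carryStep S m) ()).Runs (store w [] l lc)
        (Odometer.succ l).isSome (store w [] k kc) L ∧
      k.length + kc.length = l.length + lc.length ∧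
      ∀ l' ∈ Odometer.succ l, kc.reverse ++ k = lc.reverse ++ l' := by
  induction l generalizing lc with
  | nil =>
    have hpop := runs_pop (i := digits) h
    rw [store_set_digits] at hpop
    exact ⟨[], lc, .loop_done (hpop.bind (runs_pure h)), rfl, by simp [Odometer.succ]⟩
  | cons d l ih =>
    rw [List.length_cons] at hL
    induction d using Fin.lastCases with
    | last =>
      have hstep := runs_carryStep_last h (by omega)
      obtain ⟨k, kc, hrest, hlen, hk⟩ := ih hstep.fits (by rw [List.length_cons]; omega)
      rw [Odometer.succ_last_cons, Option.isSome_map]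
      refine ⟨k, kc, .loop_step hstep hrest, ?_, ?_⟩
      · simp only [List.length_cons] at hlen ⊢
        omega
      · rintro _ h
        obtain ⟨l', hl', rfl⟩ := Option.map_eq_some_iff.1 h
        simpa using hk l' hl'
    | cast i =>
      rw [Odometer.succ_castSucc_cons]
      exact ⟨_, _, .loop_done (runs_carryStep_castSucc h), rfl, by simp⟩

theorem runs_increment {w : List S} {l : List (Fin (m + 1))} {L : ℕ}
    (h : (store w [] l []).Fits L) :
    ∃ k, (∀ l' ∈ Odometer.succ l, k = l') ∧
      (increment S m).Runs (store w [] l []) (Odometer.succ l).isSome (store w [] k []) L := by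
  obtain ⟨k, kc, hcarry, hlen, hk⟩ := runs_carry h (h digits)
  have hl : l.length ≤ L := h digits
  have hmove := runs_move (i := digitsCopy) (j := digits) (by simp) (fun d : Fin (m + 1) => d)
    hcarry.fits (by simp only [store]; grind)
  refine ⟨kc.reverse ++ k, by simpa using hk, hcarry.bind (hmove.bind ?_)⟩
  simpa [store] using runs_pure hmove.fits

variable {κ : Type} {Γ : κ → Type} [∀ j, Finite (Γ j)] {i c : κ}

/-- Copy the input to stack `i`, and the list of digits, translated by `e`, to stack `c`. -/
def load (i c : κ) (e : Fin (m + 1) → Γ c) :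
    StackProg (SumAlphabet (SearchStack.Alphabet (Γ i) m) Γ) Unit :=
  (move (.inl input) (.inl inputCopy) fun s : Γ i => s).bind fun _ =>
  (fork (.inl inputCopy) (.inl input) (.inr i) (fun s : Γ i => s) fun s : Γ i => s).bind fun _ =>
  (move (.inl digits) (.inl digitsCopy) fun d : Fin (m + 1) => d).bind fun _ =>
  fork (.inl digitsCopy) (.inl digits) (.inr c) (fun d : Fin (m + 1) => d) e

theorem runs_load (hic : i ≠ c) (e : Fin (m + 1) → Γ c) {w : List (Γ i)} {l : List (Fin (m + 1))}
    {L : ℕ} (hw : w.length ≤ L) (hl : l.length ≤ L) :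
    (load i c e).Runs ((store w [] l []).sum (Store.empty Γ)) ()
      ((store w [] l []).sum (((Store.empty Γ).set i w).set c (l.map e))) L := by
  have hfits : ((store w [] l []).sum (Store.empty Γ)).Fits L :=
    .sum (fits_store hw (by simp) hl (by simp)) (Store.fits_empty L)
  have h₁ := runs_move (i := .inl input) (j := .inl inputCopy) (by simp) (fun s : Γ i => s) hfits
    (by simpa [store] using hw)
  have h₂ := runs_fork (t := .inl inputCopy) (i := .inl input) (j := .inr i) (by simp) (by simp)
    (by simp) (fun s : Γ i => s) (fun s : Γ i => s) h₁.fits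
    (by simpa [store, Store.empty] using hw) (by simpa [store, Store.empty] using hw)
  have h₃ := runs_move (i := .inl digits) (j := .inl digitsCopy) (by simp)
    (fun d : Fin (m + 1) => d) h₂.fits (by simpa [store] using hl)
  have h₄ := runs_fork (t := .inl digitsCopy) (i := .inl digits) (j := .inr c) (by simp) (by simp)
    (by simp) (fun d : Fin (m + 1) => d) e h₃.fits
    (by simpa [store, Store.empty] using hl)
    (by simpa [store, Store.empty, Store.set_of_ne _ hic.symm] using hl)
  refine h₁.bind (h₂.bind (h₃.bind ?_))
  convert h₄ using 1
  simp [store, Store.empty, Store.set_of_ne _ hic.symm]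

variable [Finite κ] {e : Fin (m + 1) → Γ c} {P : StackProg Γ Bool}

/-- Run `P` on the input and the current list of digits. If it returns `false`, then clear its
stacks and go on to the next list of digits. -/
noncomputable def searchStep (i c : κ) (e : Fin (m + 1) → Γ c) (P : StackProg Γ Bool) :
    StackProg (SumAlphabet (SearchStack.Alphabet (Γ i) m) Γ) (Unit ⊕ Bool) :=
  (load i c e).bind fun _ => (P.onRight _).bind fun
    | true => pure _ (.inr true)
    | false => ((clearAll Γ).onRight _).bind fun _ => ((increment (Γ i) m).onLeft Γ).bind fun r =>
      pure _ (if r then .inl () else .inr false)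

theorem runs_searchStep_of_true (hic : i ≠ c) {w : List (Γ i)} {l : List (Fin (m + 1))} {L : ℕ}
    (hs : (store w [] l []).Fits L) {τ : Store Γ}
    (h : P.Runs (((Store.empty Γ).set i w).set c (l.map e)) true τ L) :
    (searchStep i c e P).Runs ((store w [] l []).sum (Store.empty Γ)) (.inr true)
      ((store w [] l []).sum τ) L :=
  (runs_load hic e (hs input) (hs digits)).bind
    ((h.onRight hs).bind (runs_pure (h.onRight hs).fits))

theorem runs_searchStep_of_false (hic : i ≠ c) {w : List (Γ i)} {l : List (Fin (m + 1))} {L : ℕ}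
    (hs : (store w [] l []).Fits L) {τ : Store Γ}
    (h : P.Runs (((Store.empty Γ).set i w).set c (l.map e)) false τ L) :
    ∃ k, (∀ l' ∈ Odometer.succ l, k = l') ∧
      (searchStep i c e P).Runs ((store w [] l []).sum (Store.empty Γ))
        (if (Odometer.succ l).isSome then .inl () else .inr false)
        ((store w [] k []).sum (Store.empty Γ)) L := by
  obtain ⟨k, hk, hincr⟩ := runs_increment hs
  have hclear := (runs_clearAll h.fits).onRight hs
  have hincr := hincr.onLeft (Store.fits_empty (Γ := Γ) L)
  exact ⟨k, hk, (runs_load hic e (hs input) (hs digits)).bind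
    ((h.onRight hs).bind (hclear.bind (hincr.bind (runs_pure hincr.fits))))⟩

/-- Run `P` on the input and all lists of digits, starting from the current one, until it returns
`true`. -/
noncomputable abbrev searchLoop (i c : κ) (e : Fin (m + 1) → Γ c) (P : StackProg Γ Bool) :
    StackProg (SumAlphabet (SearchStack.Alphabet (Γ i) m) Γ) Bool :=
  loop (fun _ : Unit => searchStep i c e P) ()

end Search

end StackProg

namespace StackTransducer

open SearchStack

variable {α γ : Type} (T : StackTransducer α γ) {m : ℕ} {c : T.ι}

/-- Run `T` for all lists of `a * n + b` symbols in the range of `e` on the stack `c`, where `n` is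
the length of the input, until there is an output. -/
noncomputable def search (c : T.ι) (e : Fin (m + 1) → T.Γ c) (a b : ℕ) : StackTransducer α γ where
  ι := SearchStack ⊕ T.ι
  Γ := SumAlphabet (SearchStack.Alphabet (T.Γ T.input) m) T.Γ
  finite_ι := inferInstance
  finite_Γ := inferInstance
  prog := ((StackProg.initDigits (T.Γ T.input) m a b).onLeft T.Γ).bind fun _ =>
    .searchLoop T.input c e T.prog
  input := .inl .input
  output := .inr T.output
  inSym := T.inSym
  inSym_injective := T.inSym_injective
  outSym := T.outSym
  outSym_injective := T.outSym_injective

variable {T} {e : Fin (m + 1) → T.Γ c}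

theorem start_search (a b : ℕ) (x : List α) : (T.search c e a b).start x =
    (store (x.reverse.map T.inSym) [] [] []).sum (Store.empty T.Γ) := by
  change (Store.empty (SumAlphabet (Alphabet (T.Γ T.input) m) T.Γ)).set (.inl SearchStack.input)
    (x.reverse.map T.inSym) = _
  rw [← Store.empty_sum_empty, ← store_nil, Store.sum_set_inl, store_set_input]

theorem exists_runs_searchLoop (hc : T.input ≠ c) {x : List α} {n L : ℕ} (hx : x.length ≤ L)
    (hn : n ≤ L) {F : List (Fin (m + 1)) → Option (List γ)}
    (hF : ∀ l, l.length = n → T.Outputs ((T.start x).set c (l.map e)) (F l) L)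
    {l : List (Fin (m + 1))} (hl : l.length = n) :
    ∃ (o : Option (List γ)) (σ : Store (SearchStack.Alphabet (T.Γ T.input) m)) (τ : Store T.Γ),
      (StackProg.searchLoop T.input c e T.prog).Runs
        ((store (x.reverse.map T.inSym) [] l []).sum (Store.empty T.Γ)) o.isSome (σ.sum τ) L ∧
      (∀ y ∈ o, τ T.output = y.reverse.map T.outSym ∧ ∃ l', l'.length = n ∧ F l' = some y) ∧
      (o = none → ∀ l', Relation.ReflTransGen (fun l l' => Odometer.succ l = some l') l l' →
        F l' = none) := by
  refine Odometer.forall_of_forall_succ (fun l hl ih => ?_) hl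
  have hfits : (store (x.reverse.map T.inSym) [] l []).Fits L :=
    fits_store (by simpa using hx) (by simp) (by omega) (by simp)
  obtain ⟨τ, hτ, hout⟩ := hF l hl
  rcases hy : F l with _ | y <;> rw [hy] at hτ hout
  · obtain ⟨k, hk, hrun⟩ := StackProg.runs_searchStep_of_false hc hfits hτ
    rcases hsucc : Odometer.succ l with _ | l' <;> rw [hsucc] at hk hrun
    · refine ⟨none, _, _, .loop_done hrun, by simp, fun _ l' hl' => ?_⟩
      obtain rfl | ⟨_, h, -⟩ := hl'.cases_head
      exacts [hy, by simp [hsucc] at h]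
    · obtain rfl := hk l' rfl
      obtain ⟨o, σ, τ, h, hsome, hnone⟩ := ih k hsucc
      refine ⟨o, σ, τ, .loop_step hrun h, hsome, fun ho l' hl' => ?_⟩
      obtain rfl | ⟨l'', h, h'⟩ := hl'.cases_head
      · exact hy
      · obtain rfl : k = l'' := by simpa [hsucc] using h
        exact hnone ho l' h'
  · exact ⟨some y, _, τ, .loop_done (StackProg.runs_searchStep_of_true hc hfits hτ),
      by simpa [hout] using ⟨l, hl, hy⟩, by simp⟩

theorem exists_outputs_search (hc : T.input ≠ c) {a b : ℕ} {x : List α} {L : ℕ} (hx : x.length ≤ L)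
    (hL : a * x.length + b ≤ L) {F : List (Fin (m + 1)) → Option (List γ)}
    (hF : ∀ l, l.length = a * x.length + b →
      T.Outputs ((T.start x).set c (l.map e)) (F l) L) :
    ∃ o, (T.search c e a b).Outputs ((T.search c e a b).start x) o L ∧
      (∀ y ∈ o, ∃ l, l.length = a * x.length + b ∧ F l = some y) ∧
      (o = none → ∀ l, l.length = a * x.length + b → F l = none) := by
  have hinit := StackProg.runs_initDigits m (w := x.reverse.map T.inSym) (a := a) (b := b) (L := L)
    (by simpa using hx) (by simpa using hL)
  obtain ⟨o, σ, τ, h, hsome, hnone⟩ := exists_runs_searchLoop hc hx hL hF List.length_replicate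
  refine ⟨o, ⟨σ.sum τ, ?_, fun y hy => (hsome y hy).1⟩, fun y hy => (hsome y hy).2,
    fun ho l hl => hnone ho l ?_⟩
  · rw [start_search]
    rw [List.length_map, List.length_reverse] at hinit
    exact (hinit.onLeft (Store.fits_empty L)).bind h
  · exact Odometer.forall_of_succ .refl (fun l l' h h' => h'.tail h) hl

variable (T c) in
theorem exists_transducer_search [Nonempty (T.Γ c)] (hc : T.input ≠ c) (a b : ℕ) :
    ∃ T' : StackTransducer α γ, ∀ (x : List α) (F : List (T.Γ c) → Option (List γ)) (L : ℕ),
      x.length ≤ L → a * x.length + b ≤ L →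
      (∀ l, l.length = a * x.length + b → T.Outputs ((T.start x).set c l) (F l) L) →
      ∃ o, T'.Outputs (T'.start x) o L ∧
        (∀ y ∈ o, ∃ l, l.length = a * x.length + b ∧ F l = some y) ∧
        (o = none → ∀ l, l.length = a * x.length + b → F l = none) := by
  obtain ⟨n, ⟨e⟩⟩ := Finite.exists_equiv_fin (T.Γ c)
  obtain ⟨m, rfl⟩ : ∃ m, n = m + 1 :=
    Nat.exists_eq_succ_of_ne_zero (e (Classical.arbitrary _)).pos.ne'
  refine ⟨T.search c e.symm a b, fun x F L hx hL hF => ?_⟩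
  obtain ⟨o, ho, hsome, hnone⟩ := exists_outputs_search (e := e.symm)
    (F := fun l => F (l.map e.symm))
    hc hx hL fun l hl => hF _ (by simpa using hl)
  refine ⟨o, ho, fun y hy => ?_, fun h l hl => ?_⟩
  · obtain ⟨l, hl, hy⟩ := hsome y hy
    exact ⟨l.map e.symm, by simpa using hl, hy⟩
  · simpa [Function.comp_def] using hnone h (l.map e) (by simpa using hl)

end StackTransducer

/-! ### Computation paths with given choices -/

namespace ReachesIn

variable {C : Type*} {r : C → C → Prop}

theorem head_cases {t : ℕ} {c e : C} (h : ReachesIn r (t + 1) c e) :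
    ∃ d, r c d ∧ ReachesIn r t d e := by
  induction t generalizing e with
  | zero =>
    obtain - | ⟨hzero, hlast⟩ := h
    cases hzero
    exact ⟨_, hlast, .refl _⟩
  | succ t ih =>
    obtain - | ⟨hpath, hlast⟩ := h
    obtain ⟨d, hfirst, hrest⟩ := ih hpath
    exact ⟨d, hfirst, hrest.tail hlast⟩

theorem reflTransGen {t : ℕ} {c d : C} (h : ReachesIn r t c d) : Relation.ReflTransGen r c d := by
  induction h with
  | refl => exact .refl
  | tail _ h ih => exact ih.tail h

theorem exists_of_reflTransGen {c d : C} (h : Relation.ReflTransGen r c d) :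
    ∃ t, ReachesIn r t c d := by
  induction h with
  | refl => exact ⟨0, .refl c⟩
  | tail _ h ih => exact ⟨_, ih.choose_spec.tail h⟩

end ReachesIn

instance {α : Type} [Finite α] : Finite (InputSym α) :=
  Finite.of_surjective
    (fun x : Option (Option α) => match x with
      | none => InputSym.cent
      | some none => InputSym.dollar
      | some (some a) => InputSym.letter a)
    (fun s => match s with
      | .cent => ⟨none, rfl⟩
      | .dollar => ⟨some none, rfl⟩
      | .letter a => ⟨some (some a), rfl⟩)

namespace OracleNPDA

variable {α β γ : Type}

/-- The transitions of an oracle npda. -/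
structure Trans (M : OracleNPDA α β γ) where
  src : M.Q
  sym : Option (InputSym α)
  top : M.Θ
  tgt : M.Q
  word : List M.Θ
  out : Option γ
  qry : Option β
  mem : (tgt, word, out, qry) ∈ M.δ src sym top

instance finite_trans (M : OracleNPDA α β γ) [Finite α] : Finite M.Trans := by
  have := M.finite_Q
  have := M.finite_Θ
  have := fun k : M.Q × Option (InputSym α) × M.Θ =>
    (M.finite_δ k.1 k.2.1 k.2.2).to_subtype
  exact Finite.of_surjective
    (fun t : Σ k : M.Q × Option (InputSym α) × M.Θ, ↥(M.δ k.1 k.2.1 k.2.2) =>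
      (⟨t.1.1, t.1.2.1, t.1.2.2, _, _, _, _, t.2.2⟩ : M.Trans))
    (fun t => ⟨⟨(t.src, t.sym, t.top), ⟨_, t.mem⟩⟩, rfl⟩)

variable (M : OracleNPDA α β γ) (A : Language β)

open scoped Classical in
/-- The step in which the transition `t` is chosen, if it applies. In the query state the choice is
ignored. -/
noncomputable def choiceStep (t : Option M.Trans) (c : M.Config) : Option M.Config :=
  if c.state = M.query then
    some ⟨if c.queryTape ∈ A then M.yes else M.no, c.input, c.stack, c.output, []⟩
  else t.bind fun t =>
    if t.src = c.state ∧ c.state ∉ M.halt ∧ (t.sym = none ∨ c.input.head? = t.sym) ∧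
        c.stack.head? = some t.top then
      some ⟨t.tgt, if t.sym = none then c.input else c.input.tail, t.word ++ c.stack.tail,
        c.output ++ t.out.toList, c.queryTape ++ t.qry.toList⟩
    else none

open scoped Classical in
/-- The outcome of the computation path from `c` with the given choices, if it is accepting. -/
noncomputable def pathOutcome : List (Option M.Trans) → M.Config → Option (List γ)
  | [], c => if c.state ∈ M.acc then some c.output else none
  | t :: l, c => if c.state ∈ M.acc then some c.output else
      (M.choiceStep A t c).bind (pathOutcome l)

variable {M A}

theorem step_of_choiceStep {t : Option M.Trans} {c d : M.Config}
    (h : M.choiceStep A t c = some d) : M.Step A c d := by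
  obtain ⟨q, u, st, out, qt⟩ := c
  unfold choiceStep at h
  split_ifs at h with hq hA
  · obtain rfl := hq
    obtain rfl := Option.some.inj h
    exact .answerYes hA
  · obtain rfl := hq
    obtain rfl := Option.some.inj h
    exact .answerNo hA
  · obtain ⟨⟨q, s, Z, p, v, o, r, hmem⟩, rfl, h⟩ := Option.bind_eq_some_iff.1 h
    obtain ⟨⟨rfl, hhalt, hsym, htop⟩, hd⟩ := Option.ite_none_right_eq_some.1 h
    obtain rfl := Option.some.inj hd
    obtain ⟨st, rfl⟩ := List.head?_eq_some_iff.1 htop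
    cases s with
    | none => simpa using Step.lambda hhalt hq hmem
    | some s =>
      obtain ⟨u, rfl⟩ := List.head?_eq_some_iff.1 (hsym.resolve_left (Option.some_ne_none s))
      simpa using Step.read hhalt hq hmem

theorem exists_choiceStep {c d : M.Config} (h : M.Step A c d) :
    ∃ t, M.choiceStep A t c = some d := by
  cases h with
  | @read q p s u Z v st o r out qt hhalt hquery hmem =>
    exact ⟨some ⟨q, some s, Z, p, v, o, r, hmem⟩, by simp [choiceStep, hhalt, hquery]⟩
  | @lambda q p u Z v st o r out qt hhalt hquery hmem =>
    exact ⟨some ⟨q, none, Z, p, v, o, r, hmem⟩, by simp [choiceStep, hhalt, hquery]⟩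
  | answerYes h => exact ⟨none, by simp [choiceStep, h]⟩
  | answerNo h => exact ⟨none, by simp [choiceStep, h]⟩

theorem reaches_of_pathOutcome {l : List (Option M.Trans)} {c : M.Config} {y : List γ}
    (h : M.pathOutcome A l c = some y) :
    ∃ d, Relation.ReflTransGen (M.Step A) c d ∧ d.state ∈ M.acc ∧ d.output = y := by
  induction l generalizing c with
  | nil =>
    rw [pathOutcome] at h
    split_ifs at h with hc
    exact ⟨c, .refl, hc, Option.some.inj h⟩
  | cons t l ih =>
    rw [pathOutcome] at h
    split_ifs at h with hc
    · exact ⟨c, .refl, hc, Option.some.inj h⟩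
    · obtain ⟨e, he, h⟩ := Option.bind_eq_some_iff.1 h
      obtain ⟨d, hed, hd⟩ := ih h
      exact ⟨d, .head (step_of_choiceStep he) hed, hd⟩

theorem not_step_of_mem_halt {c d : M.Config} (hc : c.state ∈ M.halt) : ¬ M.Step A c d
  | .read h _ _ => h hc
  | .lambda h _ _ => h hc
  | .answerYes _ => M.query_not_halt hc
  | .answerNo _ => M.query_not_halt hc

theorem exists_pathOutcome {t T : ℕ} {c d : M.Config} (h : ReachesIn (M.Step A) t c d)
    (hd : d.state ∈ M.acc) (hT : t ≤ T) :
    ∃ l : List (Option M.Trans), l.length = T ∧ M.pathOutcome A l c = some d.output := by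
  induction T generalizing t c with
  | zero =>
    obtain rfl : t = 0 := by omega
    cases h
    exact ⟨[], rfl, by simp [pathOutcome, hd]⟩
  | succ T ih =>
    cases t with
    | zero =>
      cases h
      exact ⟨List.replicate (T + 1) none, by simp, by simp [List.replicate_succ, pathOutcome, hd]⟩
    | succ t =>
      obtain ⟨e, hstep, hrest⟩ := h.head_cases
      obtain ⟨l, hl, hout⟩ := ih hrest (by omega)
      obtain ⟨x, hx⟩ := exists_choiceStep hstep
      have hc : c.state ∉ M.acc := fun hc => not_step_of_mem_halt (Or.inl hc) hstep
      exact ⟨x :: l, by simp [hl], by simp [pathOutcome, hc, hx, hout]⟩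

end OracleNPDA

/-! ### Simulation of a computation path with given choices -/

/-- The stacks used in the simulation of an oracle npda, besides those of the decider of the oracle:
the input `raw`, the input tape, the choices still to be made, the stack, and the output in reverse
order. -/
inductive SimStack : Type
  | raw
  | input
  | choice
  | stack
  | output

namespace SimStack

instance : Finite SimStack :=
  Finite.of_injective (fun
    | raw => (0 : Fin 5)
    | input => 1
    | choice => 2
    | stack => 3
    | output => 4) (by rintro (_ | _ | _ | _ | _) (_ | _ | _ | _ | _) h <;> simp_all)

variable {α β γ : Type}

/-- The alphabets of the stacks in the simulation of `M`. -/
abbrev Alphabet (M : OracleNPDA α β γ) : SimStack → Type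
  | raw => α
  | input => InputSym α
  | choice => Option M.Trans
  | stack => M.Θ
  | output => γ

instance (M : OracleNPDA α β γ) [Finite α] [Finite γ] : ∀ i, Finite (Alphabet M i)
  | raw => inferInstanceAs (Finite α)
  | input => inferInstanceAs (Finite (InputSym α))
  | choice => inferInstanceAs (Finite (Option M.Trans))
  | stack => M.finite_Θ
  | output => inferInstanceAs (Finite γ)

variable {M : OracleNPDA α β γ}

/-- The store in the simulation of `M`. -/
def store (w : List α) (u : List (InputSym α)) (l : List (Option M.Trans)) (st : List M.Θ)
    (out : List γ) : Store (Alphabet M)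
  | raw => w
  | input => u
  | choice => l
  | stack => st
  | output => out

variable (w v : List α) (u u' : List (InputSym α)) (l l' : List (Option M.Trans))
  (st st' : List M.Θ) (out out' : List γ)

@[simp]
theorem store_set_raw : (store w u l st out).set raw v = store v u l st out := by
  funext i
  cases i <;> first | exact Store.set_same .. | exact Store.set_of_ne _ (by simp) _

@[simp]
theorem store_set_input : (store w u l st out).set input u' = store w u' l st out := by
  funext i
  cases i <;> first | exact Store.set_same .. | exact Store.set_of_ne _ (by simp) _

@[simp]
theorem store_set_choice : (store w u l st out).set choice l' = store w u l' st out := by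
  funext i
  cases i <;> first | exact Store.set_same .. | exact Store.set_of_ne _ (by simp) _

@[simp]
theorem store_set_stack : (store w u l st out).set stack st' = store w u l st' out := by
  funext i
  cases i <;> first | exact Store.set_same .. | exact Store.set_of_ne _ (by simp) _

@[simp]
theorem store_set_output : (store w u l st out).set output out' = store w u l st out' := by
  funext i
  cases i <;> first | exact Store.set_same .. | exact Store.set_of_ne _ (by simp) _

theorem store_nil : store [] [] [] [] [] = Store.empty (Alphabet M) := by
  funext i
  cases i <;> rfl

variable {w u l st out} in
theorem fits_store {L : ℕ} (hw : w.length ≤ L) (hu : u.length ≤ L) (hl : l.length ≤ L)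
    (hst : st.length ≤ L) (hout : out.length ≤ L) : (store w u l st out).Fits L
  | raw => hw
  | input => hu
  | choice => hl
  | stack => hst
  | output => hout

end SimStack

namespace StackTransducer

variable {α γ : Type} (T : StackTransducer α γ)

theorem start_input (x : List α) : T.start x T.input = x.reverse.map T.inSym :=
  Store.set_same ..

theorem start_nil : T.start [] = Store.empty T.Γ :=
  Store.set_eq_self_of_eq rfl

theorem fits_start {x : List α} {L : ℕ} (hx : x.length ≤ L) : (T.start x).Fits L :=
  (Store.fits_empty L).set (by simpa using hx)

theorem start_set_append (x y : List α) :
    (T.start x).set T.input (y.reverse.map T.inSym ++ T.start x T.input) = T.start (x ++ y) := by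
  rw [start_input, start, Store.set_set, start, List.reverse_append, List.map_append]

end StackTransducer

namespace StackProg

open scoped Classical in
/-- Check that the topmost symbol of the stack `i` is the one in `o`, and remove it. For `o = none`
nothing is done. -/
noncomputable def expect {ι : Type} {Γ : ι → Type} (i : ι) [Finite (Γ i)] (o : Option (Γ i)) :
    StackProg Γ Bool :=
  o.elim (pure Γ true) fun s => (pop i).bind fun o' => pure Γ (decide (o' = some s))

open scoped Classical in
theorem runs_expect {ι : Type} {Γ : ι → Type} {i : ι} [Finite (Γ i)] (o : Option (Γ i))
    {σ : Store Γ} {L : ℕ} (hσ : σ.Fits L) :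
    (expect i o).Runs σ (decide (o = none ∨ (σ i).head? = o))
      (σ.set i (if o = none then σ i else (σ i).tail)) L := by
  cases o with
  | none => simpa [expect] using runs_pure hσ
  | some s =>
    have hpop := runs_pop (i := i) hσ
    simpa [expect] using! hpop.bind (K := fun o' => pure Γ (decide (o' = some s)))
      (runs_pure hpop.fits)

end StackProg

namespace OracleNPDA

open SimStack StackProg

attribute [local instance] NPDA.finite_Q NPDA.finite_Θ

variable {α β γ : Type} {M : OracleNPDA α β γ} {A : Language β} {T : StackTransducer β Empty}

variable (T) in
/-- The store in the simulation that represents the configuration `c` and the choices `l`. -/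
noncomputable def simStore (c : M.Config) (l : List (Option M.Trans)) :
    Store (SumAlphabet (Alphabet M) T.Γ) :=
  (store [] c.input l c.stack c.output.reverse).sum (T.start c.queryTape)

/-- The size of a configuration without its state. -/
def Config.size (c : M.Config) : ℕ :=
  c.input.length + c.stack.length + c.output.length + c.queryTape.length

theorem fits_simStore {c : M.Config} {l : List (Option M.Trans)} {L : ℕ}
    (hc : c.size ≤ L) (hl : l.length ≤ L) : (simStore T c l).Fits L := by
  unfold Config.size at hc
  exact .sum (fits_store (by simp) (by omega) hl (by omega) (by simp; omega))
    (T.fits_start (by omega))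

/-- Write the strings of the transition `t`. -/
def writeTrans (T : StackTransducer β Empty) (t : M.Trans) :
    StackProg (SumAlphabet (Alphabet M) T.Γ) Unit :=
  (pushList (.inl .stack) t.word).bind fun _ =>
  (pushList (.inl .output) t.out.toList.reverse).bind fun _ =>
  pushList (.inr T.input) (t.qry.toList.reverse.map T.inSym)

theorem runs_writeTrans {t : M.Trans} {u : List (InputSym α)} {l : List (Option M.Trans)}
    {st : List M.Θ} {out : List γ} {qt : List β} {q : M.Q} {L : ℕ}
    (h : (simStore T ⟨q, u, st, out, qt⟩ l).Fits L)
    (h' : (simStore T ⟨t.tgt, u, t.word ++ st, out ++ t.out.toList, qt ++ t.qry.toList⟩ l).Fits L) :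
    (writeTrans T t).Runs (simStore T ⟨q, u, st, out, qt⟩ l) ()
      (simStore T ⟨t.tgt, u, t.word ++ st, out ++ t.out.toList, qt ++ t.qry.toList⟩ l) L := by
  have hword := runs_pushList (i := .inl .stack) t.word h
    (by simpa [simStore, store] using h' (.inl .stack))
  have hout := runs_pushList (i := .inl .output) t.out.toList.reverse hword.fits
    (by simpa [simStore, store, add_comm] using h' (.inl .output))
  have hqry := runs_pushList (i := .inr T.input) (t.qry.toList.reverse.map T.inSym) hout.fits
    (by simpa [simStore, store, add_comm, T.start_input] using h' (.inr T.input))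
  refine hword.bind (hout.bind ?_)
  convert hqry using 1
  simp [simStore, store, ← T.start_set_append]

section Transition

variable [Finite α]

open scoped Classical in
/-- Make the move of the transition `t` in state `q` if it applies, and return the new state. -/
noncomputable def follow (T : StackTransducer β Empty) (q : M.Q) (t : M.Trans) :
    StackProg (SumAlphabet (Alphabet M) T.Γ) (M.Q ⊕ Bool) :=
  (expect (.inl .input) t.sym).bind fun readable =>
  (expect (Γ := SumAlphabet (Alphabet M) T.Γ) (.inl .stack) (some t.top)).bind fun poppable =>
  if t.src = q ∧ q ∉ M.halt ∧ readable ∧ poppable then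
    (writeTrans T t).bind fun _ => pure _ (.inl t.tgt)
  else pure _ (.inr false)

open scoped Classical in
theorem exists_runs_follow {t : M.Trans} {c : M.Config} {l : List (Option M.Trans)} {L : ℕ}
    (hq : c.state ≠ M.query) (hc : (simStore T c l).Fits L)
    (hfits : ∀ d ∈ M.choiceStep A (some t) c, (simStore T d l).Fits L) :
    ∃ τ, (follow T c.state t).Runs (simStore T c l)
        ((M.choiceStep A (some t) c).elim (.inr false) fun d => .inl d.state) τ L ∧
      ∀ d ∈ M.choiceStep A (some t) c, τ = simStore T d l := by
  obtain ⟨q, u, st, out, qt⟩ := c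
  obtain ⟨u', hu'⟩ : ∃ u', u' = if t.sym = none then u else u.tail := ⟨_, rfl⟩
  have hsym : (expect (.inl .input) t.sym).Runs (simStore T ⟨q, u, st, out, qt⟩ l)
      (decide (t.sym = none ∨ u.head? = t.sym)) (simStore T ⟨q, u', st, out, qt⟩ l) L := by
    simpa [simStore, store, hu', -Bool.decide_or] using! runs_expect (i := .inl .input) t.sym hc
  have htop : (expect (Γ := SumAlphabet (Alphabet M) T.Γ) (.inl .stack) (some t.top)).Runs
      (simStore T ⟨q, u', st, out, qt⟩ l) (decide (st.head? = some t.top))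
      (simStore T ⟨q, u', st.tail, out, qt⟩ l) L := by
    simpa [simStore, store] using! runs_expect (Γ := SumAlphabet (Alphabet M) T.Γ)
      (i := .inl .stack) (some t.top) hsym.fits
  simp only [choiceStep, hq, if_false, Option.bind_some, ← hu'] at hfits ⊢
  by_cases happlies : t.src = q ∧ q ∉ M.halt ∧ (t.sym = none ∨ u.head? = t.sym) ∧
      st.head? = some t.top
  · rw [if_pos happlies] at hfits ⊢
    have hwrite := runs_writeTrans htop.fits (hfits _ rfl)
    refine ⟨_, hsym.bind (htop.bind ?_), fun _ h => congrArg (simStore T · l) (Option.some.inj h)⟩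
    simp only [decide_eq_true_eq, if_pos happlies]
    exact hwrite.bind (runs_pure hwrite.fits)
  · rw [if_neg happlies]
    refine ⟨simStore T ⟨q, u', st.tail, out, qt⟩ l, hsym.bind (htop.bind ?_), by simp⟩
    simp only [decide_eq_true_eq, if_neg happlies]
    exact runs_pure htop.fits

end Transition

/-- Send the query to the decider of the oracle, and return the new state. -/
def answer (M : OracleNPDA α β γ) (T : StackTransducer β Empty) :
    StackProg (SumAlphabet (Alphabet M) T.Γ) (M.Q ⊕ Bool) :=
  (T.prog.onRight _).bind fun r => pure _ (.inl (if r then M.yes else M.no))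

open scoped Classical in
theorem runs_answer {c : M.Config} {l : List (Option M.Trans)} {L : ℕ}
    (hT : T.prog.Runs (T.start c.queryTape) (decide (c.queryTape ∈ A)) (Store.empty T.Γ) L)
    (hc : (simStore T c l).Fits L) :
    (answer M T).Runs (simStore T c l) (.inl (if c.queryTape ∈ A then M.yes else M.no))
      ((store [] c.input l c.stack c.output.reverse).sum (T.start [])) L := by
  have h := hT.onRight (Γ := Alphabet M) (σ := store [] c.input l c.stack c.output.reverse)
    fun i => hc (.inl i)
  rw [T.start_nil]
  refine h.bind ?_
  simpa only [decide_eq_true_eq] using runs_pure h.fits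

variable [Finite α]

open scoped Classical in
/-- Simulate one step in state `q` with the next choice, and return the new state, or whether the
path is accepting if it ends here. -/
noncomputable def simStep (T : StackTransducer β Empty) (q : M.Q) :
    StackProg (SumAlphabet (Alphabet M) T.Γ) (M.Q ⊕ Bool) :=
  if q ∈ M.acc then pure _ (.inr true) else
    (pop (.inl .choice)).bind fun o => o.elim (pure _ (.inr false)) fun t : Option M.Trans =>
      if q = M.query then answer M T else t.elim (pure _ (.inr false)) (follow T q)

open scoped Classical in
theorem exists_runs_simStep {t : Option M.Trans} {c : M.Config} {l : List (Option M.Trans)} {L : ℕ}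
    (hacc : c.state ∉ M.acc)
    (hT : T.prog.Runs (T.start c.queryTape) (decide (c.queryTape ∈ A)) (Store.empty T.Γ) L)
    (hc : (simStore T c (t :: l)).Fits L)
    (hfits : ∀ d ∈ M.choiceStep A t c, (simStore T d l).Fits L) :
    ∃ τ, (simStep T c.state).Runs (simStore T c (t :: l))
        ((M.choiceStep A t c).elim (.inr false) fun d => .inl d.state) τ L ∧
      ∀ d ∈ M.choiceStep A t c, τ = simStore T d l := by
  have hpop : (pop (.inl .choice)).Runs (simStore T c (t :: l)) (some t) (simStore T c l) L := by
    simpa [simStore, store] using! runs_pop (i := .inl .choice) hc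
  rw [simStep, if_neg hacc]
  by_cases hq : c.state = M.query
  · have hanswer := runs_answer hT hpop.fits
    simp only [choiceStep, if_pos hq] at hfits ⊢
    refine ⟨_, hpop.bind ?_, fun _ h => congrArg (simStore T · l) (Option.some.inj h)⟩
    simpa only [if_pos hq] using! hanswer
  · cases t with
    | none =>
      simp only [choiceStep, if_neg hq] at hfits ⊢
      refine ⟨simStore T c l, hpop.bind ?_, by simp⟩
      simpa only [if_neg hq] using! runs_pure hpop.fits
    | some t =>
      obtain ⟨τ, hfollow, hτ⟩ := exists_runs_follow hq hpop.fits hfits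
      refine ⟨τ, hpop.bind ?_, hτ⟩
      simpa only [if_neg hq] using! hfollow

theorem exists_size_le_of_choiceStep (M : OracleNPDA α β γ) : ∃ K, ∀ (A : Language β)
    (t : Option M.Trans) (c d : M.Config), M.choiceStep A t c = some d → d.size ≤ c.size + K := by
  obtain ⟨K, hK⟩ := Finite.exists_le fun t : M.Trans => t.word.length
  refine ⟨K + 2, fun A t c d h => ?_⟩
  unfold choiceStep at h
  split_ifs at h
  · obtain rfl := Option.some.inj h
    grind [Config.size]
  · obtain rfl := Option.some.inj h
    grind [Config.size]
  · obtain ⟨t, rfl, h⟩ := Option.bind_eq_some_iff.1 h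
    obtain ⟨-, hd⟩ := Option.ite_none_right_eq_some.1 h
    obtain rfl := Option.some.inj hd
    have hout : t.out.toList.length ≤ 1 := by cases t.out <;> simp
    have hqry : t.qry.toList.length ≤ 1 := by cases t.qry <;> simp
    grind [Config.size, hK t]

open scoped Classical in
theorem runs_simStep_of_mem_acc {c : M.Config} (hc : c.state ∈ M.acc)
    {σ : Store (SumAlphabet (Alphabet M) T.Γ)} {L : ℕ} (hσ : σ.Fits L) :
    (simStep T c.state).Runs σ (.inr true) σ L := by
  rw [simStep, if_pos hc]
  exact runs_pure hσ

theorem runs_simStep_nil {c : M.Config} (hc : c.state ∉ M.acc) {L : ℕ}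
    (h : (simStore T c []).Fits L) :
    (simStep T c.state).Runs (simStore T c []) (.inr false) (simStore T c []) L := by
  have hpop : (pop (.inl .choice)).Runs (simStore T c []) none (simStore T c []) L := by
    simpa [simStore, store] using! runs_pop (i := .inl .choice) h
  rw [simStep, if_neg hc]
  exact hpop.bind (runs_pure h)

open scoped Classical in
theorem exists_runs_loop_simStep {K a b m L : ℕ} (hm : m ≤ L) (hL : a * m + b ≤ L)
    (hK : ∀ t (c d : M.Config), M.choiceStep A t c = some d → d.size ≤ c.size + K)
    (hT : ∀ x, T.prog.Runs (T.start x) (decide (x ∈ A)) (Store.empty T.Γ) (a * x.length + b))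
    {l : List (Option M.Trans)} {c : M.Config} (hl : l.length ≤ L)
    (hc : c.size + K * l.length ≤ m) :
    ∃ τ : Store (SumAlphabet (Alphabet M) T.Γ),
      (loop (simStep T) c.state).Runs (simStore T c l) (M.pathOutcome A l c).isSome τ L ∧
      ∀ y ∈ M.pathOutcome A l c, τ (.inl .output) = y.reverse := by
  have hfits : (simStore T c l).Fits L := fits_simStore (by lia) hl
  induction l generalizing c with
  | nil =>
    by_cases hacc : c.state ∈ M.acc
    · exact ⟨_, by simpa [pathOutcome, hacc] using (runs_simStep_of_mem_acc hacc hfits).loop_done,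
        by simp [pathOutcome, hacc, simStore, store]⟩
    · exact ⟨_, by simpa [pathOutcome, hacc] using (runs_simStep_nil hacc hfits).loop_done,
        by simp [pathOutcome, hacc]⟩
  | cons t l ih =>
    by_cases hacc : c.state ∈ M.acc
    · exact ⟨_, by simpa [pathOutcome, hacc] using (runs_simStep_of_mem_acc hacc hfits).loop_done,
        by simp [pathOutcome, hacc, simStore, store]⟩
    rw [List.length_cons] at hl hc
    have hquery : a * c.queryTape.length + b ≤ L := by
      refine le_trans ?_ hL
      gcongr
      grind [Config.size]
    have hd {d : M.Config} (h : M.choiceStep A t c = some d) : d.size + K * l.length ≤ m := by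
      linarith [hK t c d h]
    have hdfits {d : M.Config} (h : M.choiceStep A t c = some d) : (simStore T d l).Fits L :=
      fits_simStore ((le_trans (Nat.le_add_right _ _) (hd h)).trans hm) (by omega)
    obtain ⟨τ, hstep, hτ⟩ := exists_runs_simStep hacc ((hT _).mono hquery) hfits fun d => hdfits
    rw [pathOutcome, if_neg hacc]
    rcases hc : M.choiceStep A t c with _ | d <;> rw [hc] at hstep
    · exact ⟨τ, .loop_done hstep, by simp⟩
    · obtain rfl := hτ d hc
      obtain ⟨υ, hrest, hυ⟩ := ih (by omega) (hd hc) (hdfits hc)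
      exact ⟨υ, .loop_step hstep hrest, hυ⟩

/-- Write the input tape, and push the bottom marker. -/
def simInit (M : OracleNPDA α β γ) : StackProg (Alphabet M) Unit :=
  (push input InputSym.dollar).bind fun _ =>
  (move raw input InputSym.letter).bind fun _ =>
  (push input InputSym.cent).bind fun _ =>
  push stack M.Z₀

theorem runs_simInit {x : List α} {l : List (Option M.Trans)} {L : ℕ} (hx : x.length + 2 ≤ L)
    (hl : l.length ≤ L) : (simInit M).Runs (store x.reverse [] l [] []) ()
      (store [] (inputTape x) l [M.Z₀] []) L := by
  have hdollar := runs_push (i := input) (s := InputSym.dollar) (L := L)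
    (σ := store (M := M) x.reverse [] l [] [])
    (fits_store (by simp; omega) (by simp) hl (by simp) (by simp)) (by simp [store]; omega)
  have hmove := runs_move (i := raw) (j := input) (by simp) InputSym.letter hdollar.fits
    (by simp [store]; omega)
  have hcent := runs_push (i := input) (s := InputSym.cent) hmove.fits (by simp [store]; omega)
  have hbottom := runs_push (i := stack) (s := M.Z₀) hcent.fits (by simp [store]; omega)
  refine hdollar.bind (hmove.bind (hcent.bind ?_))
  simpa [store, inputTape] using! hbottom

/-- The stack transducer with the input `x` which, if the stack of choices has the content `l`,
yields the outcome of the corresponding computation path of `M`; the program of `T` answers the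
queries. -/
noncomputable def simulation [Finite γ] (M : OracleNPDA α β γ) (T : StackTransducer β Empty) :
    StackTransducer α γ where
  ι := SimStack ⊕ T.ι
  Γ := SumAlphabet (Alphabet M) T.Γ
  finite_ι := inferInstance
  finite_Γ := inferInstance
  prog := ((simInit M).onLeft T.Γ).bind fun _ => loop (simStep T) M.q₀
  input := .inl .raw
  output := .inl .output
  inSym a := a
  inSym_injective := Function.injective_id
  outSym a := a
  outSym_injective := Function.injective_id

open scoped Classical in
theorem exists_outputs_simulation [Finite γ] {a b : ℕ}
    (hT : ∀ x, T.prog.Runs (T.start x) (decide (x ∈ A)) (Store.empty T.Γ) (a * x.length + b)) :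
    ∃ K, ∀ (x : List α) (l : List (Option M.Trans)),
      (M.simulation T).Outputs (((M.simulation T).start x).set (.inl .choice) l)
        (M.pathOutcome A l (M.start x))
        ((a + 1) * (x.length + 3 + K * l.length) + b + l.length) := by
  obtain ⟨K, hK⟩ := M.exists_size_le_of_choiceStep
  refine ⟨K, fun x l => ?_⟩
  obtain ⟨m, hm⟩ : ∃ m, m = x.length + 3 + K * l.length := ⟨_, rfl⟩
  obtain ⟨L, hL⟩ : ∃ L, L = (a + 1) * m + b + l.length := ⟨_, rfl⟩
  rw [← hm, ← hL]
  have hmL : a * m + m + b + l.length = L := by rw [hL, add_one_mul]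
  have hinit := runs_simInit (M := M) (x := x) (l := l) (L := L) (by omega) (by omega)
  have hsize : (M.start x).size = x.length + 3 := by simp [Config.size, start, inputTape]
  obtain ⟨τ, hloop, hτ⟩ := exists_runs_loop_simStep (l := l) (c := M.start x)
    (show m ≤ L by omega) (by omega) (hK A) hT (by omega) (by rw [hsize, hm])
  have hstart : ((M.simulation T).start x).set (.inl .choice) l =
      (store (M := M) x.reverse [] l [] []).sum (Store.empty T.Γ) := by
    change Store.set (Store.set (Store.empty (SumAlphabet (Alphabet M) T.Γ)) (.inl .raw)
      (x.reverse.map fun a => a)) (.inl .choice) l = _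
    rw [← Store.empty_sum_empty, ← store_nil, Store.sum_set_inl, Store.sum_set_inl, store_set_raw,
      store_set_choice, List.map_id']
  have hsim : simStore T (M.start x) l =
      (store [] (inputTape x) l [M.Z₀] []).sum (Store.empty T.Γ) := by
    rw [← T.start_nil]
    rfl
  rw [hsim] at hloop
  refine ⟨τ, ?_, fun y hy => (hτ y hy).trans (List.map_id' _).symm⟩
  rw [hstart]
  exact (hinit.onLeft (Store.fits_empty _)).bind hloop

end OracleNPDA

/-! ### Languages and functions computed with an oracle that is decided in linear space -/

open scoped Classical in
/-- The language `A` is decided in linear space by a stack program. The program empties its stacks,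
so that it can be used as a subroutine any number of times. -/
def IsLinearSpaceDecidable {α : Type} (A : Language α) : Prop :=
  ∃ (T : StackTransducer α Empty) (a b : ℕ), ∀ x,
    T.prog.Runs (T.start x) (decide (x ∈ A)) (Store.empty T.Γ) (a * x.length + b)

open scoped Classical in
theorem isLinearSpaceDecidable_of_outputs {α γ : Type} {A : Language α} (T : StackTransducer α γ)
    {a b : ℕ} (h : ∀ x, ∃ o, T.Outputs (T.start x) o (a * x.length + b) ∧ (x ∈ A ↔ o.isSome)) :
    IsLinearSpaceDecidable A := by
  refine ⟨{ T with
    prog := T.prog.bind fun r => (StackProg.clearAll T.Γ).bind fun _ => .pure T.Γ r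
    outSym := Empty.elim
    outSym_injective := fun y => y.elim }, a, b, fun x => ?_⟩
  obtain ⟨o, ⟨τ, hrun, -⟩, ho⟩ := h x
  have hclear := StackProg.runs_clearAll hrun.fits
  have hr : decide (x ∈ A) = o.isSome := by simp [ho]
  rw [hr]
  exact hrun.bind (hclear.bind (StackProg.runs_pure hclear.fits))

theorem isLinearSpaceDecidable_zero : IsLinearSpaceDecidable (0 : Language Empty) := by
  refine isLinearSpaceDecidable_of_outputs (a := 0) (b := 0) (γ := Empty) ⟨Unit, fun _ => Empty,
    inferInstance, inferInstance, .pure _ false, (), (), id, Function.injective_id, id,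
    Function.injective_id⟩ fun x => ⟨none, ⟨_, StackProg.runs_pure ?_, by simp⟩, by simp⟩
  obtain rfl : x = [] := List.eq_nil_iff_forall_not_mem.2 fun s => s.elim
  exact (Store.fits_empty _).set (Nat.zero_le _)

open scoped Classical in
theorem IsLinearSpaceDecidable.compl {α : Type} {A : Language α} (hA : IsLinearSpaceDecidable A) :
    IsLinearSpaceDecidable Aᶜ := by
  obtain ⟨T, a, b, h⟩ := hA
  refine ⟨{ T with prog := T.prog.bind fun r => .pure T.Γ (!r) }, a, b, fun x => ?_⟩
  convert! (h x).bind (K := fun r => .pure T.Γ (!r)) (StackProg.runs_pure (h x).fits) using 1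
  have hmem : x ∈ Aᶜ ↔ x ∉ A := Iff.rfl
  simp [hmem]

namespace OracleNPDA

variable {α β γ : Type} [Finite α] (M : OracleNPDA α β γ) {A : Language β}

theorem exists_transducer_of_linearSpaceDecidable [Finite γ] (hA : IsLinearSpaceDecidable A)
    (a b : ℕ) :
    ∃ (T : StackTransducer α γ) (a' b' : ℕ), ∀ x, ∃ o,
      T.Outputs (T.start x) o (a' * x.length + b') ∧
      (∀ y ∈ o, y ∈ M.outcomes A x) ∧
      (o = none → ∀ t ≤ a * x.length + b, ∀ c, ReachesIn (M.Step A) t (M.start x) c →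
        c.state ∉ M.acc) := by
  obtain ⟨D, a₀, b₀, hD⟩ := hA
  obtain ⟨K, hK⟩ := exists_outputs_simulation (M := M) hD
  have : Nonempty ((M.simulation D).Γ (.inl .choice)) := ⟨(none : Option M.Trans)⟩
  obtain ⟨T, hT⟩ := (M.simulation D).exists_transducer_search (.inl .choice) (by simp [simulation])
    a b
  refine ⟨T, (a₀ + 1) * (1 + K * a) + a, (a₀ + 1) * (3 + K * b) + b₀ + b, fun x => ?_⟩
  have hL : (a₀ + 1) * (x.length + 3 + K * (a * x.length + b)) + b₀ + (a * x.length + b) =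
      ((a₀ + 1) * (1 + K * a) + a) * x.length + ((a₀ + 1) * (3 + K * b) + b₀ + b) := by ring
  have hle : x.length + 3 + K * (a * x.length + b) ≤
      (a₀ + 1) * (x.length + 3 + K * (a * x.length + b)) :=
    Nat.le_mul_of_pos_left _ a₀.succ_pos
  rw [← hL]
  obtain ⟨o, ho, hsome, hnone⟩ := hT x (fun l => M.pathOutcome A l (M.start x)) _
    (by omega) (by omega) fun l hl => hl ▸ hK x l
  refine ⟨o, ho, fun y hy => ?_, fun h t ht c hc hacc => ?_⟩
  · obtain ⟨l, -, hl⟩ := hsome y hy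
    exact reaches_of_pathOutcome hl
  · obtain ⟨l, hl, hout⟩ := exists_pathOutcome hc hacc ht
    simp [hnone h l hl] at hout

theorem isLinearSpaceDecidable [Finite γ] (hA : IsLinearSpaceDecidable A) {S : Language α}
    (a b : ℕ) (hacc : ∀ x, M.Accepts A x → x ∈ S)
    (hS : ∀ x ∈ S, ∃ t ≤ a * x.length + b, ∃ c, ReachesIn (M.Step A) t (M.start x) c ∧
      c.state ∈ M.acc) : IsLinearSpaceDecidable S := by
  obtain ⟨T, a', b', hT⟩ := M.exists_transducer_of_linearSpaceDecidable hA a b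
  refine isLinearSpaceDecidable_of_outputs T (a := a') (b := b') fun x => ?_
  obtain ⟨o, ho, hsome, hnone⟩ := hT x
  refine ⟨o, ho, fun hx => ?_, fun h => ?_⟩
  · obtain ⟨t, ht, c, hc, hcacc⟩ := hS x hx
    exact Option.isSome_iff_ne_none.2 fun h => hnone h t ht c hc hcacc
  · obtain ⟨y, hy⟩ := Option.isSome_iff_exists.1 h
    obtain ⟨c, hc, hcacc, -⟩ := hsome y hy
    exact hacc x ⟨c, hc, hcacc⟩

theorem exists_multiTapeTM [Finite γ] (hA : IsLinearSpaceDecidable A) {a b : ℕ}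
    {f : List α → Set (List γ)} (hf : ∀ x, f x = M.outcomes A x)
    (hsingle : ∀ x, (f x).Subsingleton) (htotal : ∀ x, (f x).Nonempty)
    (htime : ∀ x t c, ReachesIn (M.Step A) t (M.start x) c → t ≤ a * x.length + b) :
    ∃ N : MultiTapeTM α γ, N.LinearSpace ∧ N.Computes f := by
  obtain ⟨T, a', b', hT⟩ := M.exists_transducer_of_linearSpaceDecidable hA a b
  refine T.exists_multiTapeTM_of_outputs (a := a') (b := b') fun x => ?_
  obtain ⟨o, ho, hsome, hnone⟩ := hT x
  cases o with
  | none =>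
    obtain ⟨y, hy⟩ := htotal x
    obtain ⟨c, hc, hacc, -⟩ := hf x ▸ hy
    obtain ⟨t, hc⟩ := ReachesIn.exists_of_reflTransGen hc
    exact absurd hacc (hnone rfl t (htime x t c hc) c hc)
  | some y =>
    have hy : y ∈ f x := hf x ▸ hsome y rfl
    exact ⟨y, (hsingle x).eq_singleton_of_mem hy, ho⟩

end OracleNPDA

/-! ### Pushdown automata as oracle pushdown automata -/

namespace NPDA

variable {α γ : Type}

/-- An npda, viewed as an oracle npda that makes no queries. -/
def toOracle (N : NPDA α (Option γ)) : OracleNPDA α Empty γ where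
  Q := N.Q ⊕ Option Bool
  Θ := N.Θ
  finite_Q := by
    have := N.finite_Q
    infer_instance
  finite_Θ := N.finite_Θ
  δ q s Z := Sum.elim (fun q => (fun r => (Sum.inl r.1, r.2.1, r.2.2, none)) '' N.δ q s Z)
    (fun _ => ∅) q
  finite_δ q s Z := by
    cases q with
    | inl q => exact (N.finite_δ q s Z).image _
    | inr _ => exact Set.finite_empty
  q₀ := .inl N.q₀
  Z₀ := N.Z₀
  acc := Sum.inl '' N.acc
  rej := Sum.inl '' N.rej
  disjoint_acc_rej := (Set.disjoint_image_iff Sum.inl_injective).2 N.disjoint_acc_rej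
  query := .inr none
  yes := .inr (some true)
  no := .inr (some false)
  query_not_halt := by simp
  query_ne_yes := by simp
  query_ne_no := by simp
  yes_ne_no := by simp

/-- The configuration of `N.toOracle` for a configuration of `N`. -/
def Config.toOracle {N : NPDA α (Option γ)} (c : N.Config) : N.toOracle.Config :=
  ⟨.inl c.state, c.input, c.stack, c.output, []⟩

variable {N : NPDA α (Option γ)} {A : Language Empty}

theorem inl_mem_halt_toOracle {q : N.Q} :
    (Sum.inl q : N.toOracle.Q) ∈ N.toOracle.halt ↔ q ∈ N.halt :=
  or_congr Sum.inl_injective.mem_set_image Sum.inl_injective.mem_set_image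

theorem Step.toOracle {c d : N.Config} (h : N.Step c d) :
    N.toOracle.Step A c.toOracle d.toOracle := by
  cases h with
  | @read q p s u Z v st o out hhalt hmove =>
    exact OracleNPDA.Step.read (M := N.toOracle) (q := .inl q) (p := .inl p) (r := none) (qt := [])
      (mt inl_mem_halt_toOracle.1 hhalt) Sum.inl_ne_inr ⟨_, hmove, rfl⟩
  | @lambda q p u Z v st o out hhalt hmove =>
    exact OracleNPDA.Step.lambda (M := N.toOracle) (q := .inl q) (p := .inl p) (r := none)
      (qt := []) (mt inl_mem_halt_toOracle.1 hhalt) Sum.inl_ne_inr ⟨_, hmove, rfl⟩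

theorem exists_step_of_toOracle {c : N.Config} {d' : N.toOracle.Config}
    (h : N.toOracle.Step A c.toOracle d') : ∃ d : N.Config, d' = d.toOracle ∧ N.Step c d := by
  obtain ⟨q, u, st, out⟩ := c
  generalize hc : Config.toOracle (N := N) ⟨q, u, st, out⟩ = c' at h
  cases h with
  | @read q' p s u Z v st o r out qt hhalt _ hmove =>
    cases hc
    obtain ⟨⟨p', v', o'⟩, hδ, heq⟩ := hmove
    cases heq
    exact ⟨_, rfl, Step.read (mt inl_mem_halt_toOracle.2 hhalt) hδ⟩
  | @lambda q' p u Z v st o r out qt hhalt _ hmove =>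
    cases hc
    obtain ⟨⟨p', v', o'⟩, hδ, heq⟩ := hmove
    cases heq
    exact ⟨_, rfl, Step.lambda (mt inl_mem_halt_toOracle.2 hhalt) hδ⟩
  | answerYes => cases hc
  | answerNo => cases hc

theorem reachesIn_toOracle {t : ℕ} {c d : N.Config} (h : ReachesIn N.Step t c d) :
    ReachesIn (N.toOracle.Step A) t c.toOracle d.toOracle := by
  induction h with
  | refl => exact .refl _
  | tail _ h ih => exact ih.tail h.toOracle

theorem exists_reachesIn_of_toOracle {t : ℕ} {c : N.Config} {d' : N.toOracle.Config}
    (h : ReachesIn (N.toOracle.Step A) t c.toOracle d') :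
    ∃ d : N.Config, d' = d.toOracle ∧ ReachesIn N.Step t c d := by
  generalize hc : c.toOracle = c' at h
  induction h with
  | refl => exact ⟨c, hc.symm, .refl c⟩
  | tail _ h ih =>
    obtain ⟨d, rfl, hd⟩ := ih hc
    obtain ⟨e, rfl, he⟩ := exists_step_of_toOracle h
    exact ⟨e, rfl, hd.tail he⟩

theorem state_toOracle_mem_acc {c : N.Config} :
    c.toOracle.state ∈ N.toOracle.acc ↔ c.state ∈ N.acc :=
  Sum.inl_injective.mem_set_image

theorem outcomes_toOracle (x : List α) : N.toOracle.outcomes A x = N.outcomes x := by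
  ext y
  constructor
  · rintro ⟨c', hc, hacc, rfl⟩
    obtain ⟨t, hc⟩ := ReachesIn.exists_of_reflTransGen hc
    obtain ⟨c, rfl, hc'⟩ := exists_reachesIn_of_toOracle (c := N.start x) hc
    exact ⟨c, hc'.reflTransGen, state_toOracle_mem_acc.1 hacc, rfl⟩
  · rintro ⟨c, hc, hacc, rfl⟩
    obtain ⟨t, hc⟩ := ReachesIn.exists_of_reflTransGen hc
    exact ⟨c.toOracle, (reachesIn_toOracle hc).reflTransGen, state_toOracle_mem_acc.2 hacc, rfl⟩

end NPDA

/-! ### Short derivations in context-free grammars -/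

theorem exists_forall_of_monotone {ι : Type*} (s : Finset ι) {p : ι → ℕ → Prop}
    (hp : ∀ i, Monotone (p i)) : ∃ N, ∀ i ∈ s, (∃ n, p i n) → p i N := by
  classical
  have hbound (i : ι) : ∃ N, (∃ n, p i n) → p i N := by
    by_cases h : ∃ n, p i n
    · exact ⟨h.choose, fun _ => h.choose_spec⟩
    · exact ⟨0, fun h' => absurd h' h⟩
  choose N hN using hbound
  exact ⟨s.sup N, fun i hi h => hp i (Finset.le_sup hi) (hN i h)⟩

/-- `DerivesWithin g n s w`: the string `s` of terminals and nonterminals derives the word `w` by at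
most `n` applications of rules of `g`. The derivation is arranged as a derivation tree, whose
children at a nonterminal are the symbols of the output of a rule. -/
inductive DerivesWithin {T : Type*} (g : ContextFreeGrammar T) :
    ℕ → List (Symbol T g.NT) → List T → Prop
  | nil (n : ℕ) : DerivesWithin g n [] []
  | terminal {n : ℕ} {s : List (Symbol T g.NT)} {w : List T} (a : T) :
      DerivesWithin g n s w → DerivesWithin g n (.terminal a :: s) (a :: w)
  | rule {m n : ℕ} {s : List (Symbol T g.NT)} {v w : List T} {r : ContextFreeRule T g.NT} :
      r ∈ g.rules → DerivesWithin g m r.output v → DerivesWithin g n s w →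
      DerivesWithin g (m + n + 1) (.nonterminal r.input :: s) (v ++ w)

namespace DerivesWithin

variable {T : Type*} {g : ContextFreeGrammar T} {m n : ℕ} {s s' : List (Symbol T g.NT)}
  {v w w' : List T}

theorem mono (h : DerivesWithin g m s w) (hmn : m ≤ n) : DerivesWithin g n s w := by
  induction h generalizing n with
  | nil => exact nil n
  | terminal a _ ih => exact terminal a (ih hmn)
  | @rule m k _ _ _ _ hr hout _ _ ih =>
    have h := rule hr hout (ih (n := n - m - 1) (by omega))
    rwa [show m + (n - m - 1) + 1 = n by omega] at h

theorem append (h : DerivesWithin g m s w) (h' : DerivesWithin g n s' w') :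
    DerivesWithin g (m + n) (s ++ s') (w ++ w') := by
  induction h with
  | nil k => exact h'.mono (Nat.le_add_left n k)
  | terminal a _ ih => exact terminal a ih
  | rule hr hout _ _ ih =>
    rw [List.append_assoc]
    exact (rule hr hout ih).mono (by omega)

theorem exists_of_append (h : DerivesWithin g n (s ++ s') w) :
    ∃ u v, w = u ++ v ∧ DerivesWithin g n s u ∧ DerivesWithin g n s' v := by
  induction s generalizing n w with
  | nil => exact ⟨[], w, rfl, nil n, h⟩
  | cons X s ih =>
    cases h with
    | terminal a h =>
      obtain ⟨u, v, rfl, hu, hv⟩ := ih h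
      exact ⟨a :: u, v, rfl, terminal a hu, hv⟩
    | rule hr hout h =>
      obtain ⟨u, v, rfl, hu, hv⟩ := ih h
      exact ⟨_, v, (List.append_assoc ..).symm, rule hr hout hu, hv.mono (by omega)⟩

theorem of_rule {r : ContextFreeRule T g.NT} (hr : r ∈ g.rules)
    (h : DerivesWithin g n r.output w) : DerivesWithin g (n + 1) [.nonterminal r.input] w := by
  simpa using rule hr h (nil 0)

theorem exists_rule {A : g.NT} (h : DerivesWithin g n [.nonterminal A] w) :
    ∃ r ∈ g.rules, r.input = A ∧ ∃ m < n, DerivesWithin g m r.output w := by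
  cases h with
  | @rule m n s v w r hr hout hs =>
    cases hs
    exact ⟨r, hr, rfl, m, by omega, by simpa using hout⟩

theorem map_terminal (w : List T) : DerivesWithin g 0 (w.map .terminal) w := by
  induction w with
  | nil => exact nil 0
  | cons a w ih => exact terminal a ih

theorem exists_of_derives (h : g.Derives s (w.map .terminal)) : ∃ n, DerivesWithin g n s w := by
  induction h using Relation.ReflTransGen.head_induction_on with
  | refl => exact ⟨0, map_terminal w⟩
  | head hstep _ ih =>
    obtain ⟨r, hr, hrw⟩ := hstep
    obtain ⟨n, hn⟩ := ih
    obtain ⟨p, q, rfl, rfl⟩ := hrw.exists_parts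
    obtain ⟨_, _, rfl, hpr, hq⟩ := hn.exists_of_append
    obtain ⟨_, _, rfl, hp, hr'⟩ := hpr.exists_of_append
    exact ⟨_, (hp.append (of_rule hr hr')).append hq⟩

variable (g) in
theorem exists_nil_bound : ∃ E, ∀ A n, DerivesWithin g n [.nonterminal A] [] →
    DerivesWithin g E [.nonterminal A] [] := by
  obtain ⟨E, hE⟩ := exists_forall_of_monotone g.rules
    (p := fun r n => DerivesWithin g n [.nonterminal r.input] []) fun r _ _ hmn h => h.mono hmn
  refine ⟨E, fun A n h => ?_⟩
  obtain ⟨r, hr, rfl, -⟩ := h.exists_rule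
  exact hE r hr ⟨n, h⟩

variable (g) in
/-- Every word derived from the nonterminal `B` is derived from the string `s` with at most `c` more
steps. -/
def Chain (c : ℕ) (s : List (Symbol T g.NT)) (B : g.NT) : Prop :=
  ∀ n w, DerivesWithin g n [.nonterminal B] w → DerivesWithin g (n + c) s w

theorem Chain.mono {c c' : ℕ} {B : g.NT} (h : Chain g c s B) (hc : c ≤ c') : Chain g c' s B :=
  fun n w hB => (h n w hB).mono (by omega)

variable (g) in
theorem exists_chain_bound : ∃ N, ∀ r ∈ g.rules, ∀ r' ∈ g.rules,
    (∃ c, Chain g c [.nonterminal r.input] r'.input) →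
      Chain g N [.nonterminal r.input] r'.input := by
  obtain ⟨N, hN⟩ := exists_forall_of_monotone (g.rules ×ˢ g.rules)
    (p := fun r c => Chain g c [.nonterminal r.1.input] r.2.input) fun r _ _ hc h => h.mono hc
  exact ⟨N, fun r hr r' hr' => hN (r, r') (Finset.mk_mem_product hr hr')⟩

/-- `Yields P s w`: the word `w` is obtained from the string `s` by replacing each nonterminal `A`
with some word `v` such that `P A v`. -/
inductive Yields {N : Type*} (P : N → List T → Prop) : List (Symbol T N) → List T → Prop
  | nil : Yields P [] []
  | terminal {s : List (Symbol T N)} {w : List T} (a : T) :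
      Yields P s w → Yields P (.terminal a :: s) (a :: w)
  | nonterminal {s : List (Symbol T N)} {v w : List T} {A : N} :
      P A v → Yields P s w → Yields P (.nonterminal A :: s) (v ++ w)

theorem Yields.mono {N : Type*} {P P' : N → List T → Prop} {s : List (Symbol T N)}
    (hP : ∀ A v, P A v → P' A v) (h : Yields P s w) : Yields P' s w := by
  induction h with
  | nil => exact .nil
  | terminal a _ ih => exact .terminal a ih
  | nonterminal hA _ ih => exact .nonterminal (hP _ _ hA) ih

variable (g) in
/-- The nonterminal `A` derives the word `v`, which is shorter than `ℓ`. -/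
def DerivesShorter (ℓ : ℕ) (A : g.NT) (v : List T) : Prop :=
  v.length < ℓ ∧ ∃ n, DerivesWithin g n [.nonterminal A] v

theorem yields_or_exists_chain {ℓ : ℕ} (h : DerivesWithin g n s w) (hw : w.length ≤ ℓ) :
    Yields (DerivesShorter g ℓ) s w ∨ w.length = ℓ ∧
      ∃ B, DerivesWithin g n [.nonterminal B] w ∧ ∃ c, Chain g c s B := by
  induction h with
  | nil => exact .inl .nil
  | terminal a _ ih =>
    rw [List.length_cons] at hw
    exact .inl (.terminal a ((ih (by omega)).resolve_right (by omega)))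
  | @rule m n s v w r hr hout hs _ ih =>
    have hv := of_rule hr hout
    rw [List.length_append] at hw ⊢
    rcases (show v.length ≤ ℓ by omega).lt_or_eq with hlt | heq
    · rcases ih (by omega) with h | ⟨hℓ, B, hB, c, hc⟩
      · exact .inl (.nonterminal ⟨hlt, _, hv⟩ h)
      · obtain rfl : v = [] := List.length_eq_zero_iff.1 (by omega)
        exact .inr ⟨by simpa, B, hB.mono (by omega), m + 1 + c,
          fun k u hu => (hv.append (hc k u hu)).mono (by omega)⟩
    · obtain rfl : w = [] := List.length_eq_zero_iff.1 (by omega)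
      exact .inr ⟨by simpa, r.input, by simpa using hv.mono (by omega), n,
        fun k u hu => by simpa using hu.append hs⟩

/-- Follow the derivation tree as long as one child derives the whole word. -/
theorem exists_chain_yields {A : g.NT} (h : DerivesWithin g n [.nonterminal A] w) :
    ∃ r ∈ g.rules, (∃ c, Chain g c [.nonterminal A] r.input) ∧
      Yields (DerivesShorter g w.length) r.output w := by
  induction n using Nat.strong_induction_on generalizing A with
  | _ n ih =>
    obtain ⟨r, hr, rfl, m, hm, hout⟩ := h.exists_rule
    rcases hout.yields_or_exists_chain le_rfl with hyields | ⟨-, B, hB, c, hc⟩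
    · exact ⟨r, hr, ⟨0, fun _ _ h => h⟩, hyields⟩
    · obtain ⟨r', hr', ⟨c', hc'⟩, hyields⟩ := ih m hm hB
      exact ⟨r', hr', ⟨c' + c + 1, fun k u hu =>
        (of_rule hr (hc _ u (hc' k u hu))).mono (by omega)⟩, hyields⟩

/-- A word of length at least `ℓ` is composed of at least two parts, which saves `K` steps. -/
theorem of_yields {E K ℓ : ℕ}
    (h : Yields (fun A v => v.length < ℓ ∧
      DerivesWithin g (E + K * (2 * v.length - 1)) [.nonterminal A] v) s w) :
    DerivesWithin g (s.length * E + K * (2 * w.length - if w.length < ℓ then 1 else 2)) s w := by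
  induction h with
  | nil => exact .nil _
  | @terminal s w a _ ih =>
    refine (DerivesWithin.terminal a ih).mono ?_
    simp only [List.length_cons]
    gcongr ?_ * E + K * ?_
    · omega
    · split_ifs <;> omega
  | @nonterminal s v w A hA _ ih =>
    refine (hA.2.append ih).mono ?_
    have := hA.1
    rw [List.length_cons, List.length_append]
    generalize hd : 2 * w.length - (if w.length < ℓ then 1 else 2) = d
    have hsplit : 2 * v.length - 1 + d ≤
        2 * (v.length + w.length) - if v.length + w.length < ℓ then 1 else 2 := by
      split_ifs at hd ⊢ <;> omega
    calc E + K * (2 * v.length - 1) + (s.length * E + K * d)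
        = (s.length + 1) * E + K * (2 * v.length - 1 + d) := by ring
      _ ≤ _ := by gcongr

variable (g) in
theorem exists_linear_bound : ∃ a b, ∀ A n w, DerivesWithin g n [.nonterminal A] w →
    DerivesWithin g (a * w.length + b) [.nonterminal A] w := by
  obtain ⟨E, hE⟩ := exists_nil_bound g
  obtain ⟨N, hN⟩ := exists_chain_bound g
  obtain ⟨m, hm⟩ : ∃ m, ∀ r ∈ g.rules, r.output.length ≤ m :=
    ⟨g.rules.sup (·.output.length), fun r hr => Finset.le_sup (f := (·.output.length)) hr⟩
  obtain ⟨K, hK⟩ : ∃ K, K = m * E + 1 + N := ⟨_, rfl⟩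
  have key (ℓ : ℕ) : ∀ A n w, w.length = ℓ → DerivesWithin g n [.nonterminal A] w →
      DerivesWithin g (E + K * (2 * w.length - 1)) [.nonterminal A] w := by
    induction ℓ using Nat.strong_induction_on with
    | _ ℓ ih =>
      rintro A n w rfl h
      obtain rfl | hw := eq_or_ne w []
      · exact (hE A n h).mono (by omega)
      obtain ⟨r₀, hr₀, rfl, -⟩ := h.exists_rule
      obtain ⟨r, hr, hchain, hyields⟩ := h.exists_chain_yields
      have hout := of_yields (hyields.mono fun B v ⟨hv, k, hB⟩ => ⟨hv, ih _ hv B k v rfl hB⟩)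
      refine (hN r₀ hr₀ r hr hchain _ w (of_rule hr hout)).mono ?_
      have hlen := List.length_pos_iff.2 hw
      rw [if_neg (lt_irrefl _)]
      calc r.output.length * E + K * (2 * w.length - 2) + 1 + N
          ≤ m * E + K * (2 * w.length - 2) + 1 + N := by gcongr; exact hm r hr
        _ = K * (2 * w.length - 2 + 1) := by rw [mul_add_one, hK]; ring
        _ ≤ E + K * (2 * w.length - 1) := by
          rw [show 2 * w.length - 2 + 1 = 2 * w.length - 1 by omega]
          exact Nat.le_add_left _ _
  refine ⟨K * 2, E, fun A n w h => (key _ A n w rfl h).mono ?_⟩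
  rw [mul_assoc, add_comm]
  gcongr
  omega

end DerivesWithin

/-! ### The pushdown automaton of a context-free grammar -/

namespace GrammarPDA

/-- The states of the pushdown automaton of a grammar. -/
inductive State : Type
  | start
  | run
  | accept

instance : Finite State :=
  Finite.of_surjective (fun i : Fin 3 => ![State.start, .run, .accept] i) (by
    rintro (_ | _ | _)
    exacts [⟨0, rfl⟩, ⟨1, rfl⟩, ⟨2, rfl⟩])

variable {T : Type} (g : ContextFreeGrammar T)

/-- The terminals, and the nonterminals to which some rule applies. The type of all nonterminals may
be infinite. -/
def liveSymbols : Set (Symbol T g.NT) :=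
  Set.range .terminal ∪ (fun r => .nonterminal r.input) '' (g.rules : Set (ContextFreeRule T g.NT))

theorem finite_liveSymbols [Finite T] : (liveSymbols g).Finite :=
  (Set.finite_range _).union (g.rules.finite_toSet.image _)

/-- The stack alphabet of the pushdown automaton of a grammar: `none` is the bottom marker, and
`some none` stands for all nonterminals without rules. -/
abbrev StackSym : Type := Option (Option (liveSymbols g))

variable {g}

open Classical in
/-- The stack symbol for a symbol of the grammar. -/
noncomputable def stackSym (X : Symbol T g.NT) : StackSym g :=
  if h : X ∈ liveSymbols g then some (some ⟨X, h⟩) else some none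

theorem stackSym_ne_none {X : Symbol T g.NT} : stackSym X ≠ none := by
  unfold stackSym
  split <;> simp

theorem eq_of_stackSym_eq {X Y : Symbol T g.NT} (hY : Y ∈ liveSymbols g)
    (h : stackSym X = stackSym Y) : X = Y := by
  unfold stackSym at h
  rw [dif_pos hY] at h
  split at h
  · simpa using h
  · simp at h

variable (g)

/-- The transition function of the pushdown automaton of a grammar. -/
def trans : State → Option (InputSym T) → StackSym g →
    Set (State × List (StackSym g) × Option Empty)
  | .start, some .cent, none => {(.run, [stackSym (.nonterminal g.initial), none], none)}
  | .run, none, Z => {m | ∃ r ∈ g.rules, Z = stackSym (.nonterminal r.input) ∧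
      m = (.run, r.output.map stackSym, none)}
  | .run, some (.letter a), Z => {m | Z = stackSym (.terminal a) ∧ m = (.run, [], none)}
  | .run, some .dollar, none => {(.accept, [], none)}
  | _, _, _ => ∅

theorem finite_trans (q : State) (s : Option (InputSym T)) (Z : StackSym g) :
    (trans g q s Z).Finite := by
  unfold trans
  split
  · exact Set.finite_singleton _
  · refine (g.rules.finite_toSet.image
      fun r => (State.run, r.output.map stackSym, (none : Option Empty))).subset ?_
    rintro m ⟨r, hr, -, rfl⟩
    exact ⟨r, hr, rfl⟩
  · refine (Set.finite_singleton (State.run, [], none)).subset ?_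
    rintro m ⟨-, rfl⟩
    rfl
  · exact Set.finite_singleton _
  · exact Set.finite_empty

/-- The pushdown automaton that follows the leftmost derivations of a grammar. -/
noncomputable def npda [Finite T] : NPDA T (Option Empty) where
  Q := State
  Θ := StackSym g
  finite_Q := inferInstance
  finite_Θ := by
    have := (finite_liveSymbols g).to_subtype
    infer_instance
  δ := trans g
  finite_δ := finite_trans g
  q₀ := .start
  Z₀ := none
  acc := {.accept}
  rej := ∅
  disjoint_acc_rej := Set.disjoint_empty _

variable {g} [Finite T] {n : ℕ} {s : List (Symbol T g.NT)} {w : List T}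

/-- The configuration with the sentential form `s` on the stack and the input `w` ahead. -/
noncomputable def runConfig (s : List (Symbol T g.NT)) (w : List T) : (npda g).Config :=
  ⟨State.run, w.map .letter ++ [.dollar], s.map stackSym ++ [none], []⟩

theorem runConfig_append (s s' : List (Symbol T g.NT)) (w : List T) :
    runConfig (s ++ s') w = ⟨State.run, w.map .letter ++ [.dollar],
      (s.map stackSym ++ (s'.map stackSym ++ [none]) : List (StackSym g)), []⟩ := by
  have hstack : (s ++ s').map stackSym ++ [none] =
      s.map stackSym ++ (s'.map stackSym ++ [none]) := by
    rw [List.map_append, List.append_assoc]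
  exact congrArg (fun st : List (StackSym g) => (⟨State.run,
    w.map InputSym.letter ++ [InputSym.dollar], st, []⟩ : (npda g).Config)) hstack

theorem start_notMem_halt : State.start ∉ (npda g).halt := by
  rintro (h | h) <;> cases h

theorem run_notMem_halt : State.run ∉ (npda g).halt := by
  rintro (h | h) <;> cases h

theorem step_start_iff {d : (npda g).Config} :
    (npda g).Step ((npda g).start w) d ↔ d = runConfig [.nonterminal g.initial] w := by
  constructor
  · intro h
    generalize hc : (npda g).start w = c at h
    cases h with
    | read _ hmove =>
      cases hc
      cases hmove
      rfl
    | lambda _ hmove =>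
      cases hc
      cases hmove
  · rintro rfl
    exact NPDA.Step.read (N := npda g) (v := [_, none]) (o := none) (st := []) (out := [])
      start_notMem_halt rfl

theorem step_terminal (a : T) :
    (npda g).Step (runConfig (.terminal a :: s) (a :: w)) (runConfig s w) :=
  NPDA.Step.read (N := npda g) (v := []) (o := none) (out := []) run_notMem_halt ⟨rfl, rfl⟩

theorem step_rule {r : ContextFreeRule T g.NT} (hr : r ∈ g.rules) :
    (npda g).Step (runConfig (.nonterminal r.input :: s) w) (runConfig (r.output ++ s) w) := by
  have hmove : (State.run, r.output.map stackSym, none) ∈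
      trans g .run none (stackSym (.nonterminal r.input)) := ⟨r, hr, rfl, rfl⟩
  rw [runConfig_append]
  exact NPDA.Step.lambda (N := npda g) (u := w.map .letter ++ [.dollar])
    (st := s.map stackSym ++ [none]) (o := none) (out := []) run_notMem_halt hmove

theorem step_accept :
    (npda g).Step (runConfig (g := g) [] []) ⟨State.accept, [], [], []⟩ :=
  NPDA.Step.read (N := npda g) (v := []) (o := none) (st := []) (out := []) run_notMem_halt rfl

theorem runConfig_step_cases {d : (npda g).Config} (h : (npda g).Step (runConfig s w) d) :
    (s = [] ∧ w = []) ∨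
    (∃ a s' w', s = .terminal a :: s' ∧ w = a :: w' ∧ d = runConfig s' w') ∨
    (∃ r ∈ g.rules, ∃ s', s = .nonterminal r.input :: s' ∧ d = runConfig (r.output ++ s') w) := by
  generalize hc : runConfig s w = c at h
  cases h with
  | read _ hmove =>
    rcases w with - | ⟨a, w⟩ <;> rcases s with - | ⟨X, s⟩
    · exact .inl ⟨rfl, rfl⟩
    · cases hc
      generalize hZ : stackSym X = Z at hmove
      cases Z with
      | none => exact absurd hZ stackSym_ne_none
      | some Z => exact hmove.elim
    · cases hc
      exact absurd hmove.1.symm stackSym_ne_none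
    · cases hc
      obtain ⟨hX, hm⟩ := hmove
      cases hm
      cases eq_of_stackSym_eq (.inl ⟨a, rfl⟩) hX
      exact .inr (.inl ⟨a, s, w, rfl, rfl, rfl⟩)
  | lambda _ hmove =>
    rcases s with - | ⟨X, s⟩
    · cases hc
      obtain ⟨r, -, hZ, -⟩ := hmove
      exact absurd hZ.symm stackSym_ne_none
    · cases hc
      obtain ⟨r, hr, hX, hm⟩ := hmove
      cases hm
      cases eq_of_stackSym_eq (.inr ⟨r, hr, rfl⟩) hX
      exact .inr (.inr ⟨r, hr, s, rfl, (runConfig_append ..).symm⟩)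

theorem reachesIn_of_derivesWithin (h : DerivesWithin g n s w) (s' : List (Symbol T g.NT))
    (w' : List T) {t : ℕ} {c : (npda g).Config}
    (hc : ReachesIn (npda g).Step t c (runConfig (s ++ s') (w ++ w'))) :
    ∃ t' ≤ t + n + w.length, ReachesIn (npda g).Step t' c (runConfig s' w') := by
  induction h generalizing s' w' t with
  | nil n => exact ⟨t, by omega, hc⟩
  | terminal a _ ih =>
    obtain ⟨t', ht', h⟩ := ih s' w' (hc.tail (step_terminal a))
    exact ⟨t', by rw [List.length_cons]; omega, h⟩
  | @rule m n s v w r hr _ _ ihout ih =>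
    have hstep := hc.tail (step_rule hr)
    rw [List.append_assoc] at hstep
    obtain ⟨t₁, ht₁, h₁⟩ := ihout _ _ hstep
    obtain ⟨t₂, ht₂, h₂⟩ := ih s' w' h₁
    exact ⟨t₂, by rw [List.length_append]; omega, h₂⟩

theorem exists_accepting_of_derivesWithin (h : DerivesWithin g n [.nonterminal g.initial] w) :
    ∃ t ≤ n + w.length + 2, ∃ c, ReachesIn (npda g).Step t ((npda g).start w) c ∧
      c.state ∈ (npda g).acc := by
  have hstart := (ReachesIn.refl _).tail (step_start_iff.2 rfl : (npda g).Step ((npda g).start w) _)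
  obtain ⟨t, ht, hrun⟩ := reachesIn_of_derivesWithin h [] [] (by simpa using hstart)
  exact ⟨t + 1, by omega, _, hrun.tail step_accept, rfl⟩

theorem derives_of_reachesIn {t : ℕ} {d : (npda g).Config}
    (h : ReachesIn (npda g).Step t (runConfig s w) d) (hd : d.state ∈ (npda g).acc) :
    g.Derives s (w.map .terminal) := by
  induction t generalizing s w with
  | zero =>
    cases h
    cases hd
  | succ t ih =>
    obtain ⟨c, hstep, hc⟩ := h.head_cases
    obtain ⟨rfl, rfl⟩ | ⟨a, s, w, rfl, rfl, rfl⟩ | ⟨r, hr, s, rfl, rfl⟩ :=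
      runConfig_step_cases hstep
    · exact .refl _
    · exact (ih hc).append_left [.terminal a]
    · exact ContextFreeGrammar.Produces.trans_derives ⟨r, hr, .head s⟩ (ih hc)

theorem mem_language_of_reachesIn {t : ℕ} {d : (npda g).Config}
    (h : ReachesIn (npda g).Step t ((npda g).start w) d) (hd : d.state ∈ (npda g).acc) :
    w ∈ g.language := by
  cases t with
  | zero =>
    cases h
    cases hd
  | succ t =>
    obtain ⟨c, hstep, hc⟩ := h.head_cases
    obtain rfl := step_start_iff.1 hstep
    exact derives_of_reachesIn hc hd

end GrammarPDA

theorem isLinearSpaceDecidable_of_isContextFree {T : Type} [Finite T] {L : Language T}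
    (hL : L.IsContextFree) : IsLinearSpaceDecidable L := by
  obtain ⟨g, rfl⟩ := hL
  obtain ⟨a, b, hab⟩ := DerivesWithin.exists_linear_bound g
  refine (GrammarPDA.npda g).toOracle.isLinearSpaceDecidable isLinearSpaceDecidable_zero
    (a + 1) (b + 2) ?_ fun x hx => ?_
  · rintro x ⟨c', hc', hacc⟩
    obtain ⟨t, hc'⟩ := ReachesIn.exists_of_reflTransGen hc'
    obtain ⟨c, rfl, hc⟩ := NPDA.exists_reachesIn_of_toOracle (c := (GrammarPDA.npda g).start x) hc'
    exact GrammarPDA.mem_language_of_reachesIn hc (NPDA.state_toOracle_mem_acc.1 hacc)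
  · obtain ⟨n, hn⟩ := DerivesWithin.exists_of_derives hx
    obtain ⟨t, ht, c, hc, hacc⟩ := GrammarPDA.exists_accepting_of_derivesWithin (hab _ n x hn)
    refine ⟨t, ?_, c.toOracle, NPDA.reachesIn_toOracle hc, NPDA.state_toOracle_mem_acc.2 hacc⟩
    rw [Nat.add_mul]
    omega

/-! ### The hierarchy -/

theorem isLinearSpaceDecidable_of_mem_sigmaCFL {k : ℕ} {α : Type} [Finite α] {L : Language α}
    (hL : L ∈ SigmaCFL (k + 1) α) : IsLinearSpaceDecidable L := by
  induction k generalizing α with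
  | zero => exact isLinearSpaceDecidable_of_isContextFree hL
  | succ k ih =>
    obtain ⟨β, _, A, hA, M, ⟨a, b, hM⟩, hLM⟩ := hL
    have hA' : IsLinearSpaceDecidable A := by simpa using (ih hA).compl
    refine M.isLinearSpaceDecidable hA' a b (fun x => (hLM x).2) fun x hx => ?_
    obtain ⟨c, hc, hacc⟩ := (hLM x).1 hx
    obtain ⟨t, hc⟩ := ReachesIn.exists_of_reflTransGen hc
    exact ⟨t, (hM A x t c hc).1, c, hc, hacc⟩

theorem mainTheorem3 (k : ℕ) (hk : 1 ≤ k) (α γ : Type) [Finite α] [Finite γ]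
    (f : List α → Set (List γ)) (hf : f ∈ SigmaCFLSVt k α γ) :
    ∃ M : MultiTapeTM α γ, M.LinearSpace ∧ M.Computes f := by
  obtain ⟨⟨hf, hsingle⟩, htotal⟩ := hf
  match k, hk, hf with
  | 1, _, ⟨N, ⟨a, b, hN⟩, hfN⟩ =>
    refine N.toOracle.exists_multiTapeTM isLinearSpaceDecidable_zero (a := a) (b := b)
      (fun x => (hfN x).trans (N.outcomes_toOracle x).symm) hsingle htotal fun x t c hc => ?_
    obtain ⟨d, -, hd⟩ := NPDA.exists_reachesIn_of_toOracle (c := N.start x) hc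
    exact (hN x t d hd).1
  | k + 2, _, ⟨β, _, A, hA, M, ⟨a, b, hM⟩, hfM⟩ =>
    have hA' : IsLinearSpaceDecidable A := by
      simpa using (isLinearSpaceDecidable_of_mem_sigmaCFL hA).compl
    exact M.exists_multiTapeTM hA' hfM hsingle htotal fun x t c hc => (hM A x t c hc).1
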